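/- Let $\psi_1:\mathbb{R}^n\to\mathbb{R}\cup\{+\infty\}$ be proper, lower semicontinuous, locally strongly convex (that is, convex, and every point at which $\partial\psi_1$ is nonempty has a neighbourhood on which $\psi_1$ is strongly convex with some modulus $\sigma>0$) and 1-coercive ($\psi_1(x)/\|x\|\to\infty$ as $\|x\|\to\infty$). Let $\psi_2:\mathbb{R}^m\to\mathbb{R}\cup\{+\infty\}$ be proper, lower semicontinuous and convex, let $A\in\mathbb{R}^{m\times n}$, and suppose that there is $x\in\operatorname{relint}\operatorname{dom}\psi_1$ with $Ax\in\operatorname{relint}\operatorname{dom}\psi_2$. Let $q>r\ge\frac12$, $y^{-1}\in\mathbb{R}^m$ and $\gamma_0=\gamma_{-1}>0$. Write $\mathcal L_\gamma(x,z,y)=\psi_1(x)+\psi_2(z)+\langle y,Ax-z\rangle+\frac\gamma2\|Ax-z\|^2$, and consider the algorithm AdaAMA$^{q,r}$: starting from $$x^{-1}=\operatorname*{argmin}_x\{\psi_1(x)+\langle y^{-1},Ax\rangle\},\quad z^0=\operatorname*{argmin}_z\mathcal L_{\gamma_0}(x^{-1},z,y^{-1}),\quad y^0=y^{-1}+\gamma_0(Ax^{-1}-z^0),$$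 iterate for $k=0,1,2,\dots$ $$x^k=\operatorname*{argmin}_x\{\psi_1(x)+\langle y^k,Ax\rangle\},$$ $$\gamma_{k+1}=\gamma_k\min\left\{\sqrt{\frac1q+\frac{\gamma_k}{\gamma_{k-1}}},\ \sqrt{\frac{1-\frac rq}{[(1-2r)+\gamma_k^2L_k^2+2\gamma_k\ell_k(r-1)]_+}}\right\},$$ $$z^{k+1}=\operatorname{prox}_{\psi_2/\gamma_{k+1}}(\gamma_{k+1}^{-1}y^k+Ax^k),\qquad y^{k+1}=y^k+\gamma_{k+1}(Ax^k-z^{k+1}),$$ where $[t]_+=\max\{0,t\}$, $\operatorname{prox}_{\psi}(v)=\operatorname*{argmin}_w\{\psi(w)+\frac12\|w-v\|^2\}$ and $$\ell_k=-\frac{\langle Ax^k-Ax^{k-1},y^k-y^{k-1}\rangle}{\|y^k-y^{k-1}\|^2},\qquad L_k=\frac{\|Ax^k-Ax^{k-1}\|}{\|y^k-y^{k-1}\|},$$ with the conventions $\frac00=0$ and $\frac10=\infty$ (so that the second term of the minimum is $+\infty$ when its denominator vanishes). Then the problem $\min_{x\in\mathbb{R}^n}\psi_1(x)+\psi_2(Ax)$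 has a unique solution $x^\star$; the algorithm is well defined (all the minimizers above exist and are unique); the sequence $(x^k)$ converges to $x^\star$; and the sequence $(y^k)$ converges to a solution of the dual problem $\min_{y\in\mathbb{R}^m}\psi_1^*(-A^{\top}y)+\psi_2^*(y)$, where $\psi_i^*$ denotes the Fenchel conjugate of $\psi_i$. -/

import Mathlib

open Filter Topology

namespace AdaAMA

noncomputable section

variable {E F : Type*} [NormedAddCommGroup E] [InnerProductSpace ℝ E]
  [NormedAddCommGroup F] [InnerProductSpace ℝ F]

/-- The effective domain of an extended-real-valued function. -/
def effDom (ψ : E → EReal) : Set E := {x | ψ x < ⊤}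

/-- Proper: never `-∞` and somewhere finite. -/
def Proper (ψ : E → EReal) : Prop := (∀ x, ψ x ≠ ⊥) ∧ ∃ x, ψ x ≠ ⊤

/-- Convexity of a function with values in `ℝ ∪ {+∞}`: the effective domain is convex and the
(real) restriction to it is convex. -/
def IsConvex (ψ : E → EReal) : Prop := ConvexOn ℝ (effDom ψ) (fun x => (ψ x).toReal)

/-- The subdifferential of `ψ` at `x` (for a proper function; it is then empty outside the
effective domain). -/
def subdiff (ψ : E → EReal) (x : E) : Set E :=
  {u | ∀ z, ψ x + ((inner ℝ u (z - x) : ℝ) : EReal) ≤ ψ z}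

/-- Local strong convexity: `ψ` is convex, and every point at which it is subdifferentiable has a
ball around it on which `ψ` is strongly convex with some modulus `σ > 0`. -/
def LocallyStronglyConvex (ψ : E → EReal) : Prop :=
  IsConvex ψ ∧ ∀ x, (subdiff ψ x).Nonempty → ∃ ε > 0, ∃ σ > 0,
    StrongConvexOn (Metric.ball x ε ∩ effDom ψ) σ (fun x => (ψ x).toReal)

/-- `1`-coercivity: `ψ x / ‖x‖ → +∞` as `‖x‖ → ∞`. -/
def OneCoercive (ψ : E → EReal) : Prop :=
  Tendsto (fun x => ψ x / ((‖x‖ : ℝ) : EReal)) (Bornology.cobounded E) (𝓝 ⊤)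

/-- The set of global minimizers. -/
def argmin (φ : E → EReal) : Set E := {x | ∀ y, φ x ≤ φ y}

/-- The Fenchel conjugate. -/
def conj (ψ : E → EReal) (u : E) : EReal := ⨆ x, (((inner ℝ x u : ℝ) : EReal) - ψ x)

/-- The (set-valued) proximal mapping. -/
def prox (ψ : E → EReal) (v : E) : Set E :=
  argmin fun w => ψ w + ((1 / 2 * ‖w - v‖ ^ 2 : ℝ) : EReal)

/-- The requirements on the data of `minimize ψ₁ x + ψ₂ (A x)`. -/
structure Requirements (ψ₁ : E → EReal) (ψ₂ : F → EReal) (A : E →L[ℝ] F) : Prop where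
  proper₁ : Proper ψ₁
  closed₁ : LowerSemicontinuous ψ₁
  locallyStronglyConvex₁ : LocallyStronglyConvex ψ₁
  oneCoercive₁ : OneCoercive ψ₁
  proper₂ : Proper ψ₂
  convex₂ : IsConvex ψ₂
  closed₂ : LowerSemicontinuous ψ₂
  relint : ∃ x ∈ intrinsicInterior ℝ (effDom ψ₁), A x ∈ intrinsicInterior ℝ (effDom ψ₂)

/-- The primal objective. -/
def primal (ψ₁ : E → EReal) (ψ₂ : F → EReal) (A : E →L[ℝ] F) (x : E) : EReal :=
  ψ₁ x + ψ₂ (A x)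

/-- The (Fenchel) dual objective, to be minimized. -/
def dual [CompleteSpace E] [CompleteSpace F]
    (ψ₁ : E → EReal) (ψ₂ : F → EReal) (A : E →L[ℝ] F) (y : F) : EReal :=
  conj ψ₁ (-(ContinuousLinearMap.adjoint A y)) + conj ψ₂ y

/-- The `γ`-augmented Lagrangian. -/
def augLag (ψ₁ : E → EReal) (ψ₂ : F → EReal) (A : E →L[ℝ] F) (γ : ℝ) (x : E) (z y : F) :
    EReal :=
  ψ₁ x + ψ₂ z + ((inner ℝ y (A x - z) + γ / 2 * ‖A x - z‖ ^ 2 : ℝ) : EReal)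

/-- The curvature estimate `ℓ` from two consecutive primal-dual pairs (`0 / 0 = 0`). -/
def ell (A : E →L[ℝ] F) (x' x : E) (y' y : F) : ℝ :=
  -(inner ℝ (A x - A x') (y - y')) / ‖y - y'‖ ^ 2

/-- The Lipschitz estimate `L` from two consecutive primal-dual pairs (`0 / 0 = 0`). -/
def lip (A : E →L[ℝ] F) (x' x : E) (y' y : F) : ℝ := ‖A x - A x'‖ / ‖y - y'‖

/-- The number whose positive part is the denominator in the stepsize rule. -/
def stepDenom (r γ ℓ L : ℝ) : ℝ := (1 - 2 * r) + γ ^ 2 * L ^ 2 + 2 * γ * ℓ * (r - 1)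

/-- The next stepsize, from the last two stepsizes `γ'` (older) and `γ` and the estimates `ℓ`, `L`.
When the positive part of `stepDenom` vanishes, the second term of the minimum is `+∞`
(`1 / 0 = ∞`), so that the minimum is its first term. -/
def nextStep (q r γ' γ ℓ L : ℝ) : ℝ :=
  open Classical in
  γ * if 0 < stepDenom r γ ℓ L then
        min (√(1 / q + γ / γ')) (√((1 - r / q) / stepDenom r γ ℓ L))
      else √(1 / q + γ / γ')

/-- `(x, z, y, γ)` is the run of the adaptive alternating minimization algorithm with parameters
`q`, `r`, started from the dual point `y₀` and the stepsize `γ₀`.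
Indices are shifted by one: `x k`, `z k`, `y k`, `γ k` are the iterates with index `k - 1`, so that
`x 0`, `y 0`, `γ 0` are the iterates with index `-1`. There is no `z` with index `-1`, so that
`z 0` plays no role and is set to `0`.
"Being the argmin" includes uniqueness: the set of minimizers is a singleton. -/
structure IsRun (ψ₁ : E → EReal) (ψ₂ : F → EReal) (A : E →L[ℝ] F) (q r : ℝ)
    (y₀ : F) (γ₀ : ℝ) (x : ℕ → E) (z y : ℕ → F) (γ : ℕ → ℝ) : Prop where
  y_init : y 0 = y₀
  γ_init : γ 0 = γ₀
  γ_init' : γ 1 = γ₀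
  z_unused : z 0 = 0
  z_init : argmin (fun w => augLag ψ₁ ψ₂ A (γ 1) (x 0) w (y 0)) = {z 1}
  x_step : ∀ k, argmin (fun u => ψ₁ u + ((inner ℝ (y k) (A u) : ℝ) : EReal)) = {x k}
  γ_step : ∀ k, γ (k + 2) = nextStep q r (γ k) (γ (k + 1))
    (ell A (x k) (x (k + 1)) (y k) (y (k + 1))) (lip A (x k) (x (k + 1)) (y k) (y (k + 1)))
  z_step : ∀ k, prox (fun w => (((γ (k + 2))⁻¹ : ℝ) : EReal) * ψ₂ w)
    ((γ (k + 2))⁻¹ • y (k + 1) + A (x (k + 1))) = {z (k + 2)}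
  y_step : ∀ k, y (k + 1) = y k + γ (k + 1) • (A (x k) - z (k + 1))

end

end AdaAMA

/-!
The algorithm is the adaptive proximal gradient method on the dual objective `f + g`, where
`f y = ψ₁^* (-Aᵀ y)` and `g = ψ₂^*`: the `x`-step evaluates the gradient `-A x` of `f` at `y`, and
by Moreau's identity the `z`-step is the proximal step on `g`, with `z ∈ ∂g y`
(`IsRun.isDualRun`). Convergence rests on the following observations.

*Lyapunov function* (`IsDualRun.lyapunov`). With `ρ = γ (k + 1) / γ k` and `P k` the dual
suboptimality of `y k`, the stepsize rule is such that, for each dual solution `ys`, the quantity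
`1 / 2 * ‖y (k + 1) - ys‖ ^ 2 + γ (k + 1) * (1 + q * ρ) * P k + c * ‖y (k + 1) - y k‖ ^ 2`,
`c = q / (2 * r) - 1 / 2`, does not increase. Its decrease moreover dominates the next stepsize
times the error of the linearization of `f` at `y (k + 1)`, evaluated at `ys`, as well as the
`slack` in the second term of the minimum in the rule.

*Stepsizes* (`IsDualRun.exists_le_γ`). The dual iterates are therefore bounded. Local strong
convexity and `1`-coercivity of `ψ₁` make `∇f` Lipschitz on bounded sets
(`OneCoercive.exists_lipschitz`), and so the stepsizes are bounded away from `0`. They need not be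
bounded above.

*Primal convergence* (`IsSubgrad.tendsto_of_gap`). In primal terms the linearization error of `f` is
`ψ₁ (x k) - ψ₁ xs + ⟪ys, A (x k - xs)⟫`, where `xs` is the primal solution. It tends to `0`, and by
local strong convexity `x k` tends to `xs`.

*Dual convergence*. Now the gradients converge, so that the vanishing `slack`, divided by the square
of the stepsize, gives `z (k + 1) - A (x k) → 0` (`IsDualRun.tendsto_sub`); hence `z k → A xs`,
and by closedness of the subdifferentials each cluster point of `y` is a dual solution. Since the
Lyapunov functions of two dual solutions differ only in the distances to them, there is just one
cluster point (`exists_tendsto_of_clusterPts`).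

A dual solution exists by the constraint qualification: it is a subgradient of the value function
at `0`, obtained by an algebraic separation argument (`exists_linear_le_of_convex`,
`exists_isSubgrad_of_isMin`).
-/

namespace AdaAMA

/-! ### Proper and lower semicontinuous extended-real-valued functions -/

section EffDom

variable {E : Type*} {ψ : E → EReal}

theorem Proper.coe_toReal (hp : Proper ψ) {x : E} (hx : x ∈ effDom ψ) :
    ((ψ x).toReal : EReal) = ψ x :=
  EReal.coe_toReal (ne_of_lt hx) (hp.1 x)

theorem Proper.effDom_nonempty (hp : Proper ψ) : (effDom ψ).Nonempty :=
  let ⟨x, hx⟩ := hp.2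
  ⟨x, lt_top_iff_ne_top.2 hx⟩

theorem eq_top_of_notMem_effDom {x : E} (hx : x ∉ effDom ψ) : ψ x = ⊤ := by
  simpa [effDom] using hx

end EffDom

section Semicontinuity

variable {E : Type*} [TopologicalSpace E] {ψ : E → EReal}

theorem le_of_tendsto_of_lowerSemicontinuous (hl : LowerSemicontinuous ψ) {ι : Type*}
    {l : Filter ι} [l.NeBot] {x : ι → E} {c : ι → ℝ} {a : E} {c₀ : ℝ}
    (hx : Tendsto x l (𝓝 a)) (hc : Tendsto c l (𝓝 c₀)) (h : ∀ j, ψ (x j) ≤ (c j : EReal)) :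
    ψ a ≤ (c₀ : EReal) := by
  by_contra! hlt
  obtain ⟨d, hd1, hd2⟩ := EReal.lt_iff_exists_real_btwn.1 hlt
  have h1 : ∀ᶠ j in l, (d : EReal) < ψ (x j) := hx.eventually (hl a d hd2)
  have h2 : ∀ᶠ j in l, c j < d := hc.eventually (gt_mem_nhds (by exact_mod_cast hd1))
  obtain ⟨j, hj1, hj2⟩ := (h1.and h2).exists
  exact absurd (hj1.trans_le (h j)) (not_lt.2 (by exact_mod_cast hj2.le))

theorem lowerSemicontinuous_add_coe (hl : LowerSemicontinuous ψ) {f : E → ℝ}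
    (hf : Continuous f) : LowerSemicontinuous fun x => ψ x + (f x : EReal) :=
  hl.add' (continuous_coe_real_ereal.comp hf).lowerSemicontinuous fun _ =>
    EReal.continuousAt_add (.inr (EReal.coe_ne_bot _)) (.inr (EReal.coe_ne_top _))

end Semicontinuity

section OneCoercive

variable {E : Type*} [NormedAddCommGroup E] {ψ : E → EReal}

/-- `1`-coercivity in terms of real values. -/
theorem OneCoercive.exists_le (hco : OneCoercive ψ) (hp : Proper ψ) (M : ℝ) :
    ∃ R > 0, ∀ x ∈ effDom ψ, R ≤ ‖x‖ → M * ‖x‖ ≤ (ψ x).toReal := by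
  have h1 := hco.eventually (lt_mem_nhds (EReal.coe_lt_top M))
  obtain ⟨R, hR⟩ := (Metric.hasBasis_cobounded_compl_closedBall (0 : E)).eventually_iff.1 h1
  refine ⟨max R 0 + 1, by positivity, fun x hx hxR => ?_⟩
  have hpos : 0 < ‖x‖ := lt_of_lt_of_le (by positivity) hxR
  have h2 := hR.2 (x := x) (by
    simp only [Set.mem_compl_iff, Metric.mem_closedBall, dist_zero_right, not_le]
    linarith [le_max_left R 0])
  rw [← hp.coe_toReal hx, ← EReal.coe_div] at h2
  have h3 : M < (ψ x).toReal / ‖x‖ := by exact_mod_cast h2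
  exact ((lt_div_iff₀ hpos).1 h3).le

end OneCoercive

/-! ### Subgradients of extended-real-valued functions -/

section Subgradient

variable {E : Type*} [NormedAddCommGroup E] [InnerProductSpace ℝ E]

/-- `u` is a subgradient of `ψ` at `x`, in terms of the real values of `ψ` on its effective
domain. In contrast to `u ∈ subdiff ψ x`, no arithmetic of extended reals is involved; for proper
`ψ` the two notions agree. -/
def IsSubgrad (ψ : E → EReal) (x u : E) : Prop :=
  x ∈ effDom ψ ∧ ∀ z ∈ effDom ψ, (ψ x).toReal + inner ℝ u (z - x) ≤ (ψ z).toReal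

variable {ψ : E → EReal}

theorem IsSubgrad.mem_subdiff (hp : Proper ψ) {x u : E} (h : IsSubgrad ψ x u) :
    u ∈ subdiff ψ x := by
  intro z
  by_cases hz : z ∈ effDom ψ
  · rw [← hp.coe_toReal h.1, ← hp.coe_toReal hz]
    exact_mod_cast h.2 z hz
  · rw [eq_top_of_notMem_effDom hz]
    exact le_top

/-- The graph of the subdifferential of a proper lower semicontinuous function is closed. -/
theorem IsSubgrad.of_tendsto (hp : Proper ψ) (hl : LowerSemicontinuous ψ) {ι : Type*}
    {l : Filter ι} [l.NeBot] {x u : ι → E} {a b : E} (hx : Tendsto x l (𝓝 a))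
    (hu : Tendsto u l (𝓝 b)) (h : ∀ j, IsSubgrad ψ (x j) (u j)) : IsSubgrad ψ a b := by
  have key : ∀ z ∈ effDom ψ, ψ a ≤ (((ψ z).toReal - inner ℝ b (z - a) : ℝ) : EReal) := by
    intro z hz
    refine le_of_tendsto_of_lowerSemicontinuous hl hx
      (tendsto_const_nhds.sub (hu.inner (tendsto_const_nhds.sub hx))) fun j => ?_
    rw [← hp.coe_toReal (h j).1]
    have := (h j).2 z hz
    exact_mod_cast (by linarith)
  obtain ⟨z₀, hz₀⟩ := hp.effDom_nonempty
  have ha : a ∈ effDom ψ := (key z₀ hz₀).trans_lt (EReal.coe_lt_top _)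
  refine ⟨ha, fun z hz => ?_⟩
  have := key z hz
  rw [← hp.coe_toReal ha] at this
  have : (ψ a).toReal ≤ (ψ z).toReal - inner ℝ b (z - a) := by exact_mod_cast this
  linarith

/-- On a ball on which `ψ` is strongly convex, the error of the linearization of `ψ` at `x` grows
quadratically. The sharp constant is `σ / 2`; evaluating strong convexity at the midpoint
already gives `σ / 4`. -/
theorem IsSubgrad.quadratic_growth {x u : E} (h : IsSubgrad ψ x u) {s : Set E} {σ : ℝ}
    (hs : StrongConvexOn (s ∩ effDom ψ) σ fun x => (ψ x).toReal) (hx : x ∈ s) {z : E}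
    (hz : z ∈ s ∩ effDom ψ) :
    (ψ x).toReal + inner ℝ u (z - x) + σ / 4 * ‖z - x‖ ^ 2 ≤ (ψ z).toReal := by
  have hx' : x ∈ s ∩ effDom ψ := ⟨hx, h.1⟩
  have hm := hs.1 hx' hz (by norm_num : (0 : ℝ) ≤ 1 / 2) (by norm_num : (0 : ℝ) ≤ 1 / 2)
    (by norm_num)
  have h1 := hs.2 hx' hz (by norm_num : (0 : ℝ) ≤ 1 / 2) (by norm_num : (0 : ℝ) ≤ 1 / 2)
    (by norm_num)
  have h2 := h.2 _ hm.2
  have e : (1 / 2 : ℝ) • x + (1 / 2 : ℝ) • z - x = (1 / 2 : ℝ) • (z - x) := by module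
  rw [e, inner_smul_right] at h2
  rw [norm_sub_rev x z] at h1
  simp only [smul_eq_mul] at h1
  linarith

/-- For a locally strongly convex function the error of the linearization at `x` grows at least
linearly, quadratically near `x`. Convexity carries the local quadratic growth to the whole
domain. -/
theorem IsSubgrad.exists_growth (hp : Proper ψ) (hc : LocallyStronglyConvex ψ) {x u : E}
    (h : IsSubgrad ψ x u) : ∃ ε > 0, ∃ σ > 0, ∀ z ∈ effDom ψ,
      σ * min (‖z - x‖ ^ 2) (ε * ‖z - x‖) ≤
        (ψ z).toReal - (ψ x).toReal - inner ℝ u (z - x) := by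
  obtain ⟨ε, hε, σ, hσ, hs⟩ := hc.2 x ⟨u, h.mem_subdiff hp⟩
  refine ⟨ε / 2, by positivity, σ / 4, by positivity, fun z hz => ?_⟩
  have hxb : x ∈ Metric.ball x ε := Metric.mem_ball_self hε
  by_cases hzb : ‖z - x‖ ≤ ε / 2
  · have hzb' : z ∈ Metric.ball x ε := by
      rw [Metric.mem_ball, dist_eq_norm]; linarith
    have := h.quadratic_growth hs hxb ⟨hzb', hz⟩
    have h2 : σ / 4 * min (‖z - x‖ ^ 2) (ε / 2 * ‖z - x‖) ≤ σ / 4 * ‖z - x‖ ^ 2 := by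
      gcongr; exact min_le_left _ _
    linarith
  · push Not at hzb
    -- move towards `x` until the distance is `ε / 2`
    have hd : 0 < ‖z - x‖ := by linarith
    set t : ℝ := ε / 2 / ‖z - x‖ with ht
    have ht0 : 0 < t := by positivity
    have ht1 : t ≤ 1 := (div_le_one hd).2 hzb.le
    have htd : t * ‖z - x‖ = ε / 2 := by rw [ht]; field_simp
    have hmem := hc.1.1 h.1 hz (by linarith : 0 ≤ 1 - t) ht0.le (by ring)
    have hconv := hc.1.2 h.1 hz (by linarith : 0 ≤ 1 - t) ht0.le (by ring)
    have e : (1 - t) • x + t • z - x = t • (z - x) := by module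
    have hb : (1 - t) • x + t • z ∈ Metric.ball x ε := by
      rw [Metric.mem_ball, dist_eq_norm, e, norm_smul, Real.norm_of_nonneg ht0.le, htd]
      linarith
    have := h.quadratic_growth hs hxb ⟨hb, hmem⟩
    rw [e, inner_smul_right, norm_smul, Real.norm_of_nonneg ht0.le] at this
    simp only [smul_eq_mul] at hconv
    have h2 : t * (σ / 4 * (ε / 2 * ‖z - x‖)) ≤
        t * ((ψ z).toReal - (ψ x).toReal - inner ℝ u (z - x)) := by
      have : σ / 4 * (t * ‖z - x‖) ^ 2 = t * (σ / 4 * (ε / 2 * ‖z - x‖)) := by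
        rw [← htd]; ring
      linarith
    have h3 := le_of_mul_le_mul_left h2 ht0
    have h4 : σ / 4 * min (‖z - x‖ ^ 2) (ε / 2 * ‖z - x‖) ≤ σ / 4 * (ε / 2 * ‖z - x‖) := by
      gcongr; exact min_le_right _ _
    linarith

/-- Points at which the error of the linearization at `x` vanishes asymptotically converge
to `x`. -/
theorem IsSubgrad.tendsto_of_gap (hp : Proper ψ) (hc : LocallyStronglyConvex ψ) {x u : E}
    (h : IsSubgrad ψ x u) {ι : Type*} {l : Filter ι} {z : ι → E} (hz : ∀ j, z j ∈ effDom ψ)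
    (hgap : Tendsto (fun j => (ψ (z j)).toReal - (ψ x).toReal - inner ℝ u (z j - x)) l (𝓝 0)) :
    Tendsto z l (𝓝 x) := by
  obtain ⟨ε, hε, σ, hσ, hgr⟩ := h.exists_growth hp hc
  rw [Metric.tendsto_nhds]
  intro δ hδ
  filter_upwards [hgap.eventually (gt_mem_nhds (by positivity : 0 < σ * min (δ ^ 2) (ε * δ)))]
    with j hj
  rw [dist_eq_norm]
  by_contra! hle
  have : σ * min (δ ^ 2) (ε * δ) ≤ σ * min (‖z j - x‖ ^ 2) (ε * ‖z j - x‖) := by gcongr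
  linarith [hgr (z j) (hz j)]

theorem IsSubgrad.eq_of_le (hp : Proper ψ) (hc : LocallyStronglyConvex ψ) {x u z : E}
    (h : IsSubgrad ψ x u) (hz : z ∈ effDom ψ)
    (hle : (ψ z).toReal ≤ (ψ x).toReal + inner ℝ u (z - x)) : z = x := by
  have hgap : (ψ z).toReal - (ψ x).toReal - inner ℝ u (z - x) = 0 := by
    linarith [h.2 z hz]
  exact tendsto_nhds_unique tendsto_const_nhds
    (h.tendsto_of_gap hp hc (l := (atTop : Filter ℕ)) (z := fun _ => z) (fun _ => hz)
      (by simp only [hgap]; exact tendsto_const_nhds))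

theorem IsSubgrad.unique (hp : Proper ψ) (hc : LocallyStronglyConvex ψ) {x u z : E}
    (h : IsSubgrad ψ x u) (hz : IsSubgrad ψ z u) : z = x := by
  refine h.eq_of_le hp hc hz.1 ?_
  have := hz.2 x h.1
  rw [inner_sub_right] at *
  linarith

theorem exists_mem_argmin [FiniteDimensional ℝ E] {φ : E → EReal} (hl : LowerSemicontinuous φ)
    (x₀ : E) (R : ℝ) (hR : ∀ x, R < ‖x‖ → φ x₀ ≤ φ x) : ∃ x, x ∈ argmin φ := by
  obtain ⟨x, hx, hmin⟩ := LowerSemicontinuousOn.exists_isMinOn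
    (s := Metric.closedBall 0 (max R ‖x₀‖)) ⟨x₀, by simp⟩
    (isCompact_closedBall _ _) (hl.lowerSemicontinuousOn _)
  refine ⟨x, fun z => ?_⟩
  by_cases hz : z ∈ Metric.closedBall (0 : E) (max R ‖x₀‖)
  · exact hmin hz
  · have hx₀ : x₀ ∈ Metric.closedBall (0 : E) (max R ‖x₀‖) := by simp
    refine (hmin hx₀).trans (hR z ?_)
    simp only [Metric.mem_closedBall, dist_zero_right, not_le] at hz
    exact (le_max_left _ _).trans_lt hz

/-- The subgradients in a ball are attained in a ball, by `1`-coercivity. -/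
theorem OneCoercive.exists_bound (hco : OneCoercive ψ) (hp : Proper ψ) (R : ℝ) :
    ∃ B, ∀ x u, ‖u‖ ≤ R → IsSubgrad ψ x u → ‖x‖ ≤ B := by
  obtain ⟨x₀, hx₀⟩ := hp.effDom_nonempty
  obtain ⟨R₁, -, hR₁⟩ := hco.exists_le hp (R + 1)
  refine ⟨max R₁ ((ψ x₀).toReal + R * ‖x₀‖), fun x u hu h => ?_⟩
  by_contra! hlt
  obtain ⟨h1, h2⟩ := max_lt_iff.1 hlt
  have h3 := hR₁ x h.1 h1.le
  have h4 := h.2 x₀ hx₀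
  have h5 : -(R * (‖x₀‖ + ‖x‖)) ≤ inner ℝ u (x₀ - x) := by
    have ha : |inner ℝ u (x₀ - x)| ≤ ‖u‖ * ‖x₀ - x‖ := abs_real_inner_le_norm _ _
    have hb : ‖u‖ * ‖x₀ - x‖ ≤ R * (‖x₀‖ + ‖x‖) :=
      mul_le_mul hu (norm_sub_le _ _) (norm_nonneg _) ((norm_nonneg u).trans hu)
    linarith [(abs_le.1 ha).1]
  linarith

/-- The subdifferential of a closed `1`-coercive function is onto. -/
theorem OneCoercive.exists_isSubgrad [FiniteDimensional ℝ E] (hco : OneCoercive ψ)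
    (hp : Proper ψ) (hl : LowerSemicontinuous ψ) (u : E) : ∃ x, IsSubgrad ψ x u := by
  obtain ⟨x₀, hx₀⟩ := hp.effDom_nonempty
  obtain ⟨R₁, -, hR₁⟩ := hco.exists_le hp (‖u‖ + 1)
  obtain ⟨x, hx⟩ := exists_mem_argmin
    (φ := fun x => ψ x + ((-inner ℝ u x : ℝ) : EReal))
    (lowerSemicontinuous_add_coe hl (by fun_prop)) x₀
    (max R₁ ((ψ x₀).toReal - inner ℝ u x₀)) (by
      intro x hx
      obtain ⟨h1, h2⟩ := max_lt_iff.1 hx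
      by_cases hxd : x ∈ effDom ψ
      · have h3 := hR₁ x hxd h1.le
        have h4 := real_inner_le_norm u x
        rw [← hp.coe_toReal hx₀, ← hp.coe_toReal hxd]
        exact_mod_cast (by linarith)
      · rw [eq_top_of_notMem_effDom hxd, EReal.top_add_coe]
        exact le_top)
  have hxd : x ∈ effDom ψ := by
    by_contra hxd
    have := hx x₀
    dsimp only at this
    rw [eq_top_of_notMem_effDom hxd, EReal.top_add_coe, ← hp.coe_toReal hx₀] at this
    exact absurd this (not_le.2 (by exact_mod_cast EReal.coe_lt_top _))
  refine ⟨x, hxd, fun z hz => ?_⟩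
  have := hx z
  dsimp only at this
  rw [← hp.coe_toReal hxd, ← hp.coe_toReal hz] at this
  have : (ψ x).toReal + -inner ℝ u x ≤ (ψ z).toReal + -inner ℝ u z := by exact_mod_cast this
  rw [inner_sub_right]
  linarith

/-- The gradient of the conjugate of a locally strongly convex, `1`-coercive function is Lipschitz
on bounded sets: otherwise pairs violating the Lipschitz bounds would accumulate at a single
point `(x, u)` of the graph of the subdifferential, near which strong convexity bounds the
Lipschitz constant. -/
theorem OneCoercive.exists_lipschitz [FiniteDimensional ℝ E] (hco : OneCoercive ψ)
    (hp : Proper ψ) (hl : LowerSemicontinuous ψ) (hc : LocallyStronglyConvex ψ) (R : ℝ) :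
    ∃ L > 0, ∀ x x' u u', ‖u‖ ≤ R → ‖u'‖ ≤ R → IsSubgrad ψ x u → IsSubgrad ψ x' u' →
      ‖x - x'‖ ≤ L * ‖u - u'‖ := by
  by_contra! hcon
  choose x x' u u' hu hu' hx hx' hlt using fun j : ℕ => hcon (j + 1) (by positivity)
  obtain ⟨B, hB⟩ := hco.exists_bound hp R
  obtain ⟨⟨⟨a, a'⟩, b, b'⟩, -, φ, hφ, hlim⟩ :=
    tendsto_subseq_of_bounded
      (s := (Metric.closedBall (0 : E) B ×ˢ Metric.closedBall (0 : E) B) ×ˢ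
        (Metric.closedBall (0 : E) R ×ˢ Metric.closedBall (0 : E) R))
      ((Metric.isBounded_closedBall.prod Metric.isBounded_closedBall).prod
        (Metric.isBounded_closedBall.prod Metric.isBounded_closedBall))
      (x := fun j => ((x j, x' j), u j, u' j))
      (fun j => by
        simp only [Set.mem_prod, Metric.mem_closedBall, dist_zero_right]
        exact ⟨⟨hB _ _ (hu j) (hx j), hB _ _ (hu' j) (hx' j)⟩, hu j, hu' j⟩)
  rw [Prod.tendsto_iff, Prod.tendsto_iff, Prod.tendsto_iff] at hlim
  obtain ⟨⟨ha, ha'⟩, hb, hb'⟩ := hlim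
  simp only [Function.comp_def] at ha ha' hb hb'
  have hab := IsSubgrad.of_tendsto hp hl ha hb fun j => hx (φ j)
  have hab' := IsSubgrad.of_tendsto hp hl ha' hb' fun j => hx' (φ j)
  have hbb : b = b' := by
    have h1 : Tendsto (fun j => ‖u (φ j) - u' (φ j)‖) atTop (𝓝 0) := by
      refine squeeze_zero (fun _ => norm_nonneg _) (fun j => ?_)
        ((tendsto_one_div_add_atTop_nhds_zero_nat.const_mul (2 * B)).comp hφ.tendsto_atTop
          |>.trans (by simp))
      have h2 := (norm_sub_le _ _).trans
        (add_le_add (hB _ _ (hu (φ j)) (hx (φ j))) (hB _ _ (hu' (φ j)) (hx' (φ j))))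
      have h3 := hlt (φ j)
      simp only [Function.comp_def, mul_one_div]
      rw [le_div_iff₀ (by positivity)]
      linarith
    have h2 := tendsto_nhds_unique h1 (hb.sub hb').norm
    exact sub_eq_zero.1 (norm_eq_zero.1 h2.symm)
  subst hbb
  have haa : a' = a := hab.unique hp hc hab'
  subst haa
  obtain ⟨ε, hε, σ, hσ, hs⟩ := hc.2 a' ⟨b, hab.mem_subdiff hp⟩
  have e1 := ha.eventually (Metric.ball_mem_nhds a' hε)
  have e2 := ha'.eventually (Metric.ball_mem_nhds a' hε)
  have e3 := (tendsto_natCast_atTop_atTop (R := ℝ)).eventually_ge_atTop (2 / σ)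
  obtain ⟨j, hj1, hj2, hj3⟩ := (e1.and (e2.and (hφ.tendsto_atTop.eventually e3))).exists
  have g1 := (hx (φ j)).quadratic_growth hs hj1 ⟨hj2, (hx' _).1⟩
  have g2 := (hx' (φ j)).quadratic_growth hs hj2 ⟨hj1, (hx _).1⟩
  have h3 := hlt (φ j)
  set p := x (φ j)
  set p' := x' (φ j)
  set v := u (φ j)
  set v' := u' (φ j)
  have g3 : σ / 2 * ‖p - p'‖ ^ 2 ≤ ‖v - v'‖ * ‖p - p'‖ := by
    have := real_inner_le_norm (v - v') (p - p')
    rw [norm_sub_rev p' p] at g1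
    have e : inner ℝ (v - v') (p - p') = -inner ℝ v (p' - p) - inner ℝ v' (p - p') := by
      simp only [inner_sub_left, inner_sub_right]; ring
    linarith
  have hpos : 0 < ‖p - p'‖ := lt_of_le_of_lt (by positivity) h3
  have g4 : σ / 2 * ‖p - p'‖ ≤ ‖v - v'‖ := by
    refine le_of_mul_le_mul_right ?_ hpos
    linarith
  have g5 : σ / 2 * ((φ j + 1) * ‖v - v'‖) < ‖v - v'‖ :=
    lt_of_lt_of_le (by gcongr) g4
  have g6 : 1 ≤ σ / 2 * (φ j) := by
    have : σ / 2 * (2 / σ) ≤ σ / 2 * (φ j) := by gcongr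
    have e : σ / 2 * (2 / σ) = 1 := by field_simp
    linarith
  nlinarith [norm_nonneg (v - v'), mul_le_mul_of_nonneg_right g6 (norm_nonneg (v - v')),
    mul_nonneg hσ.le (norm_nonneg (v - v'))]

end Subgradient

/-! ### Duality through linear separation -/

section Separation

/-- Algebraic separation: a convex set `S ⊆ V × ℝ` that meets the axis `{0} × ℝ` only in
`[0, ∞)` lies above the graph of a linear functional, provided that its projection to `V` is
surrounded by `0` within its own linear span (this is what the relative interior provides; no
topology is needed). The functional comes from the M. Riesz extension theorem for the cone
generated by `S`. -/
theorem exists_linear_le_of_convex {V : Type*} [AddCommGroup V] [Module ℝ V] {S : Set (V × ℝ)}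
    (hS : Convex ℝ S) (hne : S.Nonempty) (h0 : ∀ t, ((0 : V), t) ∈ S → 0 ≤ t)
    (habs : ∀ p ∈ S, ∃ ε > (0 : ℝ), ∃ t, (-(ε • p.1), t) ∈ S) :
    ∃ φ : V →ₗ[ℝ] ℝ, ∀ p ∈ S, φ p.1 ≤ p.2 := by
  -- the cone generated by a projection of `S` is a linear subspace
  have hcone : ∀ {a b : ℝ} {p p' : V × ℝ}, 0 ≤ a → 0 ≤ b → p ∈ S → p' ∈ S →
      ∃ c ≥ (0 : ℝ), ∃ s ∈ S, a • p + b • p' = c • s := by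
    intro a b p p' ha hb hp hp'
    rcases (add_nonneg ha hb).eq_or_lt with h | h
    · refine ⟨0, le_rfl, p, hp, ?_⟩
      rw [show a = 0 by linarith, show b = 0 by linarith]
      simp
    · refine ⟨a + b, h.le, (a / (a + b)) • p + (b / (a + b)) • p',
        hS hp hp' (by positivity) (by positivity) (by field_simp), ?_⟩
      rw [smul_add, smul_smul, smul_smul]
      congr 2 <;> field_simp
  obtain ⟨p₀, hp₀⟩ := hne
  let W : Submodule ℝ V :=
    { carrier := {w | ∃ c ≥ (0 : ℝ), ∃ p ∈ S, w = c • p.1}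
      zero_mem' := ⟨0, le_rfl, p₀, hp₀, by simp⟩
      add_mem' := by
        rintro _ _ ⟨a, ha, p, hp, rfl⟩ ⟨b, hb, p', hp', rfl⟩
        obtain ⟨c, hc, s, hs, e⟩ := hcone ha hb hp hp'
        exact ⟨c, hc, s, hs, by simpa using congrArg Prod.fst e⟩
      smul_mem' := by
        rintro d _ ⟨a, ha, p, hp, rfl⟩
        rcases le_total 0 d with hd | hd
        · exact ⟨d * a, by positivity, p, hp, by rw [smul_smul]⟩
        · obtain ⟨ε, hε, t, ht⟩ := habs p hp
          refine ⟨-(d * a) / ε, div_nonneg (by nlinarith) hε.le, _, ht, ?_⟩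
          dsimp only
          rw [smul_neg, smul_smul, smul_smul, ← neg_smul]
          congr 1
          field_simp }
  let K : PointedCone ℝ (W × ℝ) :=
    { carrier := {w | ∃ c ≥ (0 : ℝ), ∃ p ∈ S, ((w.1 : V), w.2) = c • p}
      zero_mem' := ⟨0, le_rfl, p₀, hp₀, by simp⟩
      add_mem' := by
        rintro w w' ⟨a, ha, p, hp, e⟩ ⟨b, hb, p', hp', e'⟩
        obtain ⟨c, hc, s, hs, e''⟩ := hcone ha hb hp hp'
        refine ⟨c, hc, s, hs, ?_⟩
        rw [← e'', ← e, ← e']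
        simp
      smul_mem' := by
        rintro ⟨d, hd⟩ w ⟨a, ha, p, hp, e⟩
        refine ⟨d * a, mul_nonneg hd ha, p, hp, ?_⟩
        rw [mul_smul, ← e]
        rfl }
  let f : (W × ℝ) →ₗ.[ℝ] ℝ :=
    ⟨LinearMap.ker (LinearMap.fst ℝ W ℝ), (LinearMap.snd ℝ W ℝ).domRestrict _⟩
  obtain ⟨g, hg, hgK⟩ := riesz_extension K f
    (by
      rintro ⟨⟨w, t⟩, hw⟩ ⟨c, hc, p, hp, e⟩
      have hw' : w = 0 := hw
      subst hw'
      change 0 ≤ t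
      have e1 : (0 : V) = c • p.1 := congrArg Prod.fst e
      have e2 : t = c * p.2 := congrArg Prod.snd e
      rcases hc.eq_or_lt with h | h
      · rw [e2, ← h]; simp
      · have h1 : p.1 = 0 := by
          rcases smul_eq_zero.1 e1.symm with h2 | h2
          · exact absurd h2 h.ne'
          · exact h2
        have h2 : 0 ≤ p.2 := h0 p.2 (by rw [← h1]; exact hp)
        rw [e2]; positivity)
    (by
      rintro ⟨⟨w, c, hc, p, hp, e⟩, t⟩
      refine ⟨⟨(0, c * p.2 - t), rfl⟩, c, hc, p, hp, ?_⟩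
      ext <;> simp [e])
  obtain ⟨φ, hφ⟩ := LinearMap.exists_extend (-(g ∘ₗ LinearMap.inl ℝ W ℝ))
  refine ⟨φ, fun p hp => ?_⟩
  have hpW : p.1 ∈ W := ⟨1, zero_le_one, p, hp, by simp⟩
  have h1 := hgK (⟨p.1, hpW⟩, p.2) ⟨1, zero_le_one, p, hp, by simp⟩
  have h2 : g ((0 : W), p.2) = p.2 := hg ⟨(0, p.2), rfl⟩
  have h3 : φ p.1 = -g (⟨p.1, hpW⟩, 0) := by
    have := LinearMap.congr_fun hφ ⟨p.1, hpW⟩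
    simpa using this
  have h4 : g (⟨p.1, hpW⟩, p.2) = g (⟨p.1, hpW⟩, 0) + g ((0 : W), p.2) := by
    rw [← map_add]; simp
  linarith

/-- A point in the relative interior can be moved slightly beyond, away from any other point of
the set. -/
theorem exists_sub_smul_mem_of_intrinsicInterior {E : Type*} [NormedAddCommGroup E]
    [NormedSpace ℝ E] {C : Set E} {x₀ x : E}
    (hx₀ : x₀ ∈ intrinsicInterior ℝ C) (hx : x ∈ C) :
    ∀ᶠ ε in 𝓝[>] (0 : ℝ), x₀ - ε • (x - x₀) ∈ C := by
  obtain ⟨y, hy, rfl⟩ := mem_intrinsicInterior.1 hx₀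
  have hxs : x ∈ affineSpan ℝ C := subset_affineSpan ℝ C hx
  have hmem : ∀ ε : ℝ, (y : E) - ε • (x - y) ∈ affineSpan ℝ C := fun ε => by
    have := AffineMap.lineMap_mem (-ε) y.2 hxs
    rw [AffineMap.lineMap_apply] at this
    simpa [sub_eq_neg_add, smul_add, add_comm, add_left_comm] using this
  let F : ℝ → affineSpan ℝ C := fun ε => ⟨(y : E) - ε • (x - y), hmem ε⟩
  have hF : Continuous F := by
    refine Continuous.subtype_mk ?_ _
    fun_prop
  have hF0 : F 0 = y := by
    ext; simp [F]
  have : ∀ᶠ ε in 𝓝 (0 : ℝ), F ε ∈ ((↑) ⁻¹' C : Set (affineSpan ℝ C)) :=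
    hF.continuousAt.preimage_mem_nhds (by rw [hF0]; exact mem_interior_iff_mem_nhds.1 hy)
  filter_upwards [nhdsWithin_le_nhds this] with ε hε
  exact hε

end Separation

section Duality

variable {E F : Type*} [NormedAddCommGroup E] [InnerProductSpace ℝ E]
  [NormedAddCommGroup F] [InnerProductSpace ℝ F]

/-- **Fenchel duality.** At a point `xs` minimizing `ψ₁ + ψ₂ ∘ A` over the effective domain, the
constraint qualification yields a dual solution `y`, in the form of the Karush-Kuhn-Tucker
conditions. It is the slope at `0` of the convex value function
`w ↦ inf {ψ₁ x + ψ₂ z | z - A x = w}`. -/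
theorem exists_isSubgrad_of_isMin [CompleteSpace E] [FiniteDimensional ℝ F] {ψ₁ : E → EReal}
    {ψ₂ : F → EReal} {A : E →L[ℝ] F} (hc₁ : IsConvex ψ₁) (hc₂ : IsConvex ψ₂)
    (hri : ∃ x ∈ intrinsicInterior ℝ (effDom ψ₁), A x ∈ intrinsicInterior ℝ (effDom ψ₂))
    {xs : E} (h₁ : xs ∈ effDom ψ₁) (h₂ : A xs ∈ effDom ψ₂)
    (hmin : ∀ x ∈ effDom ψ₁, A x ∈ effDom ψ₂ →
      (ψ₁ xs).toReal + (ψ₂ (A xs)).toReal ≤ (ψ₁ x).toReal + (ψ₂ (A x)).toReal) :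
    ∃ y : F, IsSubgrad ψ₁ xs (-(ContinuousLinearMap.adjoint A y)) ∧
      IsSubgrad ψ₂ (A xs) y := by
  obtain ⟨x₀, hx₀, hz₀⟩ := hri
  let S : Set (F × ℝ) := {p | ∃ x ∈ effDom ψ₁, ∃ z ∈ effDom ψ₂, p.1 = z - A x ∧
    (ψ₁ x).toReal + (ψ₂ z).toReal - ((ψ₁ xs).toReal + (ψ₂ (A xs)).toReal) ≤ p.2}
  obtain ⟨φ, hφ⟩ := exists_linear_le_of_convex (S := S)
    (by
      rintro p ⟨x, hx, z, hz, e, hle⟩ p' ⟨x', hx', z', hz', e', hle'⟩ a b ha hb hab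
      refine ⟨a • x + b • x', hc₁.1 hx hx' ha hb hab, a • z + b • z', hc₂.1 hz hz' ha hb hab,
        ?_, ?_⟩
      · simp only [Prod.fst_add, Prod.smul_fst, e, e', map_add, map_smul]
        module
      · have c₁ := hc₁.2 hx hx' ha hb hab
        have c₂ := hc₂.2 hz hz' ha hb hab
        simp only [Prod.snd_add, Prod.smul_snd, smul_eq_mul] at *
        have i₁ := mul_le_mul_of_nonneg_left hle ha
        have i₂ := mul_le_mul_of_nonneg_left hle' hb
        have i₃ : a * ((ψ₁ xs).toReal + (ψ₂ (A xs)).toReal) +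
            b * ((ψ₁ xs).toReal + (ψ₂ (A xs)).toReal) =
            (ψ₁ xs).toReal + (ψ₂ (A xs)).toReal := by rw [← add_mul, hab, one_mul]
        linarith)
    ⟨(A xs - A xs, 0), xs, h₁, A xs, h₂, rfl, by simp⟩
    (by
      rintro t ⟨x, hx, z, hz, e, hle⟩
      have e' : z = A x := sub_eq_zero.1 e.symm
      subst e'
      have := hmin x hx hz
      dsimp only at hle
      linarith)
    (by
      rintro p ⟨x, hx, z, hz, e, -⟩
      obtain ⟨ε, ⟨hε₁, hε₂⟩, hε⟩ := (((exists_sub_smul_mem_of_intrinsicInterior hx₀ hx).and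
        (exists_sub_smul_mem_of_intrinsicInterior hz₀ hz)).and self_mem_nhdsWithin).exists
      refine ⟨ε, hε, _, _, hε₁, _, hε₂, ?_, le_rfl⟩
      simp only [e, map_sub, map_smul]
      module)
  obtain ⟨y, hy⟩ : ∃ y : F, ∀ w, φ w = inner ℝ y w :=
    ⟨(InnerProductSpace.toDual ℝ F).symm (LinearMap.toContinuousLinearMap φ), fun w => by simp⟩
  have key : ∀ x ∈ effDom ψ₁, ∀ z ∈ effDom ψ₂, inner ℝ y (z - A x) ≤
      (ψ₁ x).toReal + (ψ₂ z).toReal - ((ψ₁ xs).toReal + (ψ₂ (A xs)).toReal) := by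
    intro x hx z hz
    rw [← hy]
    exact hφ (z - A x, _) ⟨x, hx, z, hz, rfl, le_rfl⟩
  refine ⟨y, ⟨h₁, fun x hx => ?_⟩, ⟨h₂, fun z hz => ?_⟩⟩
  · have := key x hx _ h₂
    rw [← map_sub] at this
    rw [inner_neg_left, ContinuousLinearMap.adjoint_inner_left, ← inner_neg_right, ← map_neg,
      neg_sub]
    linarith
  · have := key xs h₁ z hz
    linarith

/-- A convex function has a subgradient at each point of the relative interior of its
effective domain. -/
theorem exists_isSubgrad_of_intrinsicInterior [FiniteDimensional ℝ F] {ψ : F → EReal}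
    (hc : IsConvex ψ) {z₀ : F} (hz₀ : z₀ ∈ intrinsicInterior ℝ (effDom ψ)) :
    ∃ u, IsSubgrad ψ z₀ u := by
  have hmem := intrinsicInterior_subset hz₀
  let S : Set (F × ℝ) := {p | z₀ + p.1 ∈ effDom ψ ∧ (ψ (z₀ + p.1)).toReal - (ψ z₀).toReal ≤ p.2}
  obtain ⟨φ, hφ⟩ := exists_linear_le_of_convex (S := S)
    (by
      rintro p ⟨hp, hle⟩ p' ⟨hp', hle'⟩ a b ha hb hab
      have e : z₀ + (a • p + b • p').1 = a • (z₀ + p.1) + b • (z₀ + p'.1) := by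
        simp only [Prod.fst_add, Prod.smul_fst]
        rw [smul_add, smul_add, add_add_add_comm, ← add_smul, hab, one_smul]
      have c := hc.2 hp hp' ha hb hab
      refine ⟨by rw [e]; exact hc.1 hp hp' ha hb hab, ?_⟩
      rw [e]
      simp only [Prod.snd_add, Prod.smul_snd, smul_eq_mul] at *
      have i₁ := mul_le_mul_of_nonneg_left hle ha
      have i₂ := mul_le_mul_of_nonneg_left hle' hb
      have i₃ : a * (ψ z₀).toReal + b * (ψ z₀).toReal = (ψ z₀).toReal := by
        rw [← add_mul, hab, one_mul]
      linarith)
    ⟨(0, 0), by simpa [S] using hmem⟩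
    (by
      rintro t ⟨-, hle⟩
      simpa using hle)
    (by
      rintro p ⟨hp, -⟩
      obtain ⟨ε, hε₁, hε⟩ := ((exists_sub_smul_mem_of_intrinsicInterior hz₀ hp).and
        self_mem_nhdsWithin).exists
      rw [add_sub_cancel_left] at hε₁
      exact ⟨ε, hε, (ψ (z₀ + -(ε • p.1))).toReal - (ψ z₀).toReal,
        by simpa [sub_eq_add_neg] using hε₁, le_rfl⟩)
  refine ⟨(InnerProductSpace.toDual ℝ F).symm (LinearMap.toContinuousLinearMap φ), hmem,
    fun z hz => ?_⟩
  have := hφ (z - z₀, (ψ z).toReal - (ψ z₀).toReal) (by simpa [S] using hz)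
  simp only [InnerProductSpace.toDual_symm_apply, LinearMap.coe_toContinuousLinearMap']
  linarith

end Duality

/-! ### Proximal steps -/

/-- The set of minimizers of a function that is finite exactly on `D`, with values `Φ` there. -/
theorem mem_argmin_iff_of_real {F : Type*} {φ : F → EReal} {D : Set F} {Φ : F → ℝ}
    (hne : D.Nonempty)
    (hD : ∀ w ∈ D, φ w = (Φ w : EReal)) (htop : ∀ w ∉ D, φ w = ⊤) {z : F} :
    z ∈ argmin φ ↔ z ∈ D ∧ ∀ w ∈ D, Φ z ≤ Φ w := by
  constructor
  · intro hz
    have hzD : z ∈ D := by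
      by_contra hzD
      obtain ⟨w, hw⟩ := hne
      have := hz w
      rw [htop z hzD, hD w hw] at this
      exact absurd this (not_le.2 (EReal.coe_lt_top _))
    refine ⟨hzD, fun w hw => ?_⟩
    have := hz w
    rw [hD z hzD, hD w hw] at this
    exact_mod_cast this
  · rintro ⟨hzD, hz⟩ w
    by_cases hw : w ∈ D
    · rw [hD z hzD, hD w hw]
      exact_mod_cast hz w hw
    · rw [htop w hw]
      exact le_top

section Prox

variable {F : Type*} [NormedAddCommGroup F] [InnerProductSpace ℝ F] {ψ : F → EReal}

/-- Existence for the proximal problem, in the form of its optimality condition. -/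
theorem exists_isSubgrad_prox [FiniteDimensional ℝ F] (hp : Proper ψ)
    (hl : LowerSemicontinuous ψ) (hc : IsConvex ψ) {z₀ u₀ : F} (hz₀ : IsSubgrad ψ z₀ u₀)
    {γ : ℝ} (hγ : 0 < γ) (v : F) : ∃ z, IsSubgrad ψ z (γ • (v - z)) := by
  obtain ⟨z, hz⟩ := exists_mem_argmin
    (φ := fun w => ψ w + ((γ / 2 * ‖w - v‖ ^ 2 : ℝ) : EReal))
    (lowerSemicontinuous_add_coe hl (by fun_prop)) z₀
    (‖v‖ + (‖z₀ - v‖ + 2 * ‖u₀‖ / γ)) (by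
      intro w hw
      by_cases hwd : w ∈ effDom ψ
      · -- with `a = ‖w - v‖` and `b = ‖z₀ - v‖` the subgradient inequality gives
        -- `ψ w - ψ z₀ ≥ -‖u₀‖ (a + b)`, and `γ (a - b) ≥ 2 ‖u₀‖`
        have h1 := hz₀.2 w hwd
        have h2 : ‖z₀ - v‖ + 2 * ‖u₀‖ / γ ≤ ‖w - v‖ := by
          have := norm_sub_norm_le w v
          linarith
        have h3 : -(‖u₀‖ * (‖w - v‖ + ‖z₀ - v‖)) ≤ inner ℝ u₀ (w - z₀) := by
          have ha : |inner ℝ u₀ (w - z₀)| ≤ ‖u₀‖ * ‖w - z₀‖ := abs_real_inner_le_norm _ _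
          have hb : ‖w - z₀‖ ≤ ‖w - v‖ + ‖z₀ - v‖ := by
            rw [norm_sub_rev z₀ v]
            exact norm_sub_le_norm_sub_add_norm_sub w v z₀
          have := mul_le_mul_of_nonneg_left hb (norm_nonneg u₀)
          linarith [(abs_le.1 ha).1]
        have h4 : 2 * ‖u₀‖ ≤ γ * (‖w - v‖ - ‖z₀ - v‖) := by
          have := mul_le_mul_of_nonneg_left h2 hγ.le
          rw [mul_add, mul_div_cancel₀ _ hγ.ne'] at this
          linarith
        have h5 := mul_le_mul_of_nonneg_right h4
          (add_nonneg (norm_nonneg (w - v)) (norm_nonneg (z₀ - v)))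
        rw [← hp.coe_toReal hz₀.1, ← hp.coe_toReal hwd]
        exact_mod_cast (by nlinarith)
      · rw [eq_top_of_notMem_effDom hwd, EReal.top_add_coe]
        exact le_top)
  rw [mem_argmin_iff_of_real (D := effDom ψ)
    (Φ := fun w => (ψ w).toReal + γ / 2 * ‖w - v‖ ^ 2) hp.effDom_nonempty
    (fun w hw => by
      rw [EReal.coe_add, hp.coe_toReal hw])
    (fun w hw => by rw [eq_top_of_notMem_effDom hw, EReal.top_add_coe])] at hz
  obtain ⟨hzd, hz⟩ := hz
  refine ⟨z, hzd, fun w hw => ?_⟩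
  -- compare `z` with `z + t • (w - z)` and let `t` tend to `0`
  have key : ∀ t : ℝ, 0 < t → t < 1 →
      0 ≤ (ψ w).toReal - (ψ z).toReal + γ * inner ℝ (z - v) (w - z) +
        t * (γ / 2 * ‖w - z‖ ^ 2) := by
    intro t ht0 ht1
    have hm := hc.1 hzd hw (by linarith : 0 ≤ 1 - t) ht0.le (by ring)
    have h1 := hc.2 hzd hw (by linarith : 0 ≤ 1 - t) ht0.le (by ring)
    have h2 := hz _ hm
    have e : (1 - t) • z + t • w - v = (z - v) + t • (w - z) := by module
    rw [e, norm_add_sq_real, norm_smul, Real.norm_of_nonneg ht0.le, inner_smul_right] at h2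
    simp only [smul_eq_mul] at h1
    refine nonneg_of_mul_nonneg_right (b := _) (a := t) ?_ ht0
    nlinarith
  have hlim : Tendsto (fun t : ℝ => (ψ w).toReal - (ψ z).toReal + γ * inner ℝ (z - v) (w - z) +
        t * (γ / 2 * ‖w - z‖ ^ 2)) (𝓝[>] 0)
      (𝓝 ((ψ w).toReal - (ψ z).toReal + γ * inner ℝ (z - v) (w - z) +
        0 * (γ / 2 * ‖w - z‖ ^ 2))) :=
    tendsto_nhdsWithin_of_tendsto_nhds
      (tendsto_const_nhds.add (tendsto_id.mul tendsto_const_nhds))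
  have := ge_of_tendsto hlim (by
    filter_upwards [Ioo_mem_nhdsGT (zero_lt_one (α := ℝ))] with t ht using key t ht.1 ht.2)
  rw [inner_smul_left, ← neg_sub z v, inner_neg_left]
  simp only [conj_trivial]
  linarith

/-- The optimality condition of the proximal problem is sufficient, and its solution is unique.
The objective is allowed to be any positive multiple of the proximal objective, up to a
constant. -/
theorem IsSubgrad.argmin_eq_singleton {φ : F → EReal} {a c γ : ℝ} {v z : F} (hc : 0 < c)
    (hγ : 0 < γ) (hz : IsSubgrad ψ z (γ • (v - z)))
    (hφ : ∀ w ∈ effDom ψ, φ w = ((a + c * ((ψ w).toReal + γ / 2 * ‖w - v‖ ^ 2) : ℝ) : EReal))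
    (htop : ∀ w ∉ effDom ψ, φ w = ⊤) : argmin φ = {z} := by
  have key : ∀ w ∈ effDom ψ, (ψ z).toReal + γ / 2 * ‖z - v‖ ^ 2 + γ / 2 * ‖w - z‖ ^ 2 ≤
      (ψ w).toReal + γ / 2 * ‖w - v‖ ^ 2 := by
    intro w hw
    have h1 := hz.2 w hw
    have e : w - v = (w - z) - (v - z) := by abel
    have e2 : ‖w - v‖ ^ 2 = ‖w - z‖ ^ 2 - 2 * inner ℝ (v - z) (w - z) + ‖z - v‖ ^ 2 := by
      rw [e, norm_sub_sq_real, real_inner_comm, norm_sub_rev v z]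
    rw [inner_smul_left] at h1
    simp only [conj_trivial] at h1
    rw [e2]
    linarith
  ext w
  rw [mem_argmin_iff_of_real ⟨z, hz.1⟩ hφ htop, Set.mem_singleton_iff]
  constructor
  · rintro ⟨hw, hmin⟩
    have h1 := le_of_mul_le_mul_left (le_of_add_le_add_left (hmin z hz.1)) hc
    have h2 := key w hw
    have h3 : ‖w - z‖ ^ 2 ≤ 0 := by nlinarith
    exact sub_eq_zero.1 (norm_eq_zero.1 (pow_eq_zero_iff two_ne_zero |>.1
      (le_antisymm h3 (sq_nonneg _))))
  · rintro rfl
    refine ⟨hz.1, fun w' hw' => ?_⟩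
    have := key w' hw'
    have h2 : 0 ≤ γ / 2 * ‖w' - w‖ ^ 2 := by positivity
    gcongr a + c * ?_
    linarith

end Prox

/-! ### The stepsize rule -/

section StepRule

variable {q r γ' γ ℓ L : ℝ}

theorem nextStep_eq_or (q r γ' γ ℓ L : ℝ) :
    nextStep q r γ' γ ℓ L = γ * √(1 / q + γ / γ') ∨
      0 < stepDenom r γ ℓ L ∧ nextStep q r γ' γ ℓ L = γ * √((1 - r / q) / stepDenom r γ ℓ L) := by
  unfold nextStep
  split_ifs with h
  · rcases min_choice (√(1 / q + γ / γ')) (√((1 - r / q) / stepDenom r γ ℓ L)) with e | e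
    · exact .inl (by rw [e])
    · exact .inr ⟨h, by rw [e]⟩
  · exact .inl rfl

theorem nextStep_pos (hr : 1 / 2 ≤ r) (hqr : r < q) (hγ' : 0 < γ') (hγ : 0 < γ) :
    0 < nextStep q r γ' γ ℓ L := by
  have hq : 0 < q := by linarith
  have h1 : 0 < 1 - r / q := by rw [sub_pos, div_lt_one hq]; exact hqr
  rcases nextStep_eq_or q r γ' γ ℓ L with e | ⟨h, e⟩ <;> rw [e] <;> positivity

theorem pos_of_nextStep {γ : ℕ → ℝ} (hr : 1 / 2 ≤ r) (hqr : r < q) (h₀ : 0 < γ 0) (h₁ : 0 < γ 1)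
    (h : ∀ k, ∃ ℓ L, γ (k + 2) = nextStep q r (γ k) (γ (k + 1)) ℓ L) (k : ℕ) : 0 < γ k := by
  have : ∀ k, 0 < γ k ∧ 0 < γ (k + 1) := by
    intro k
    induction k with
    | zero => exact ⟨h₀, h₁⟩
    | succ k ih =>
      obtain ⟨ℓ, L, e⟩ := h k
      exact ⟨ih.2, by rw [e]; exact nextStep_pos hr hqr ih.1 ih.2⟩
  exact (this k).1

theorem sq_nextStep_div_le (hr : 1 / 2 ≤ r) (hqr : r < q) (hγ' : 0 < γ') (hγ : 0 < γ) :
    (nextStep q r γ' γ ℓ L / γ) ^ 2 ≤ 1 / q + γ / γ' := by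
  have hq : 0 < q := by linarith
  have h1 : nextStep q r γ' γ ℓ L / γ ≤ √(1 / q + γ / γ') := by
    unfold nextStep
    rw [mul_div_cancel_left₀ _ hγ.ne']
    split_ifs with h
    · exact min_le_left _ _
    · exact le_rfl
  calc _ ≤ √(1 / q + γ / γ') ^ 2 :=
        pow_le_pow_left₀ (div_pos (nextStep_pos hr hqr hγ' hγ) hγ).le h1 2
    _ = _ := Real.sq_sqrt (by positivity)

theorem sq_nextStep_div_mul_stepDenom_le (hr : 1 / 2 ≤ r) (hqr : r < q) (hγ' : 0 < γ')
    (hγ : 0 < γ) :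
    (nextStep q r γ' γ ℓ L / γ) ^ 2 * stepDenom r γ ℓ L ≤ 1 - r / q := by
  have hq : 0 < q := by linarith
  have h1 : 0 < 1 - r / q := by rw [sub_pos, div_lt_one hq]; exact hqr
  by_cases h : 0 < stepDenom r γ ℓ L
  · have h2 : nextStep q r γ' γ ℓ L / γ ≤ √((1 - r / q) / stepDenom r γ ℓ L) := by
      unfold nextStep
      rw [mul_div_cancel_left₀ _ hγ.ne', if_pos h]
      exact min_le_right _ _
    rw [← le_div_iff₀ h]
    calc _ ≤ √((1 - r / q) / stepDenom r γ ℓ L) ^ 2 :=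
          pow_le_pow_left₀ (div_pos (nextStep_pos hr hqr hγ' hγ) hγ).le h2 2
      _ = _ := Real.sq_sqrt (by positivity)
  · exact (mul_nonpos_of_nonneg_of_nonpos (sq_nonneg _) (not_lt.1 h)).trans h1.le

/-- By convexity `0 ≤ ℓ ≤ L`, and the denominator in the stepsize rule is then of the
order `γ ^ 2 * L ^ 2`. -/
theorem stepDenom_le (hr : 1 / 2 ≤ r) (hγ : 0 < γ) (hℓ : 0 ≤ ℓ) (hℓL : ℓ ≤ L) :
    stepDenom r γ ℓ L ≤ 2 * r * (γ ^ 2 * L ^ 2) := by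
  unfold stepDenom
  have ht : 0 ≤ γ * L := mul_nonneg hγ.le (hℓ.trans hℓL)
  rcases le_total r 1 with h | h
  · have h1 : 2 * γ * ℓ * (r - 1) ≤ 0 :=
      mul_nonpos_of_nonneg_of_nonpos (by positivity) (by linarith)
    have h2 : 0 ≤ (2 * r - 1) * (γ * L) ^ 2 := mul_nonneg (by linarith) (sq_nonneg _)
    nlinarith
  · have h1 : 2 * γ * ℓ * (r - 1) ≤ 2 * γ * L * (r - 1) :=
      mul_le_mul_of_nonneg_right (by gcongr) (by linarith)
    have h2 : 0 ≤ (2 * r - 1) * (γ * L - 1) ^ 2 := mul_nonneg (by linarith) (sq_nonneg _)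
    have h3 : 0 ≤ r * (γ * L) := by positivity
    nlinarith

/-- If the second term of the minimum is active, the new stepsize is at least of the order of the
inverse Lipschitz constant. -/
theorem nextStep_eq_or_le (hr : 1 / 2 ≤ r) (hqr : r < q) (hγ' : 0 < γ') (hγ : 0 < γ)
    (hℓ : 0 ≤ ℓ) (hℓL : ℓ ≤ L) {κ L₀ : ℝ} (hL : L ≤ L₀)
    (hκ : κ ^ 2 * (2 * r * L₀ ^ 2) ≤ 1 - r / q) :
    nextStep q r γ' γ ℓ L * (nextStep q r γ' γ ℓ L / γ) = γ * (1 / q + γ / γ') ∨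
      κ ≤ nextStep q r γ' γ ℓ L := by
  have hq : 0 < q := by linarith
  have h1 : 0 < 1 - r / q := by rw [sub_pos, div_lt_one hq]; exact hqr
  rcases nextStep_eq_or q r γ' γ ℓ L with e | ⟨h, e⟩
  · left
    rw [e, mul_div_cancel_left₀ _ hγ.ne', mul_assoc, Real.mul_self_sqrt (by positivity)]
  · right
    have hL0 : 0 ≤ L := hℓ.trans hℓL
    refine le_of_sq_le_sq ?_ (nextStep_pos hr hqr hγ' hγ).le
    rw [e, mul_pow, Real.sq_sqrt (by positivity), ← mul_div_assoc, le_div_iff₀ h]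
    calc κ ^ 2 * stepDenom r γ ℓ L ≤ κ ^ 2 * (2 * r * (γ ^ 2 * L₀ ^ 2)) := by
          refine mul_le_mul_of_nonneg_left ((stepDenom_le hr hγ hℓ hℓL).trans ?_) (sq_nonneg _)
          have : L ^ 2 ≤ L₀ ^ 2 := pow_le_pow_left₀ hL0 hL 2
          gcongr
      _ = γ ^ 2 * (κ ^ 2 * (2 * r * L₀ ^ 2)) := by ring
      _ ≤ γ ^ 2 * (1 - r / q) := by gcongr

end StepRule

/-! ### One proximal gradient step -/

section OneStep

variable {F : Type*} [NormedAddCommGroup F] [InnerProductSpace ℝ F]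

theorem le_of_sq_le_of_le_mul {C p d X : ℝ} (hC : 1 / 2 ≤ C) (hd : 0 ≤ d)
    (h₁ : d ^ 2 ≤ X) (h₂ : X ≤ p * d) : X ≤ C * p ^ 2 + (1 - C) * d ^ 2 := by
  rcases hd.eq_or_lt with rfl | hd
  · have : 0 ≤ C * p ^ 2 := by positivity
    nlinarith
  · have hdp : d ≤ p := le_of_mul_le_mul_right (by nlinarith) hd
    have h3 : 0 ≤ C * (p - d) ^ 2 + (2 * C - 1) * (d * (p - d)) :=
      add_nonneg (by positivity) (mul_nonneg (by linarith) (mul_nonneg hd.le (by linarith)))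
    nlinarith

/-- The descent inequality for two consecutive proximal gradient steps `u ↦ w ↦ w'` on `f + g`,
where `f`, `f'` are the values of the smooth part at `u`, `w`, with gradients `-a`, `-a'`, and
`g`, `g'`, `g''` the values of the other part at `u`, `w`, `w'`, with subgradients `z`, `z'` at `w`,
`w'`. At a solution `ys` the two parts have the values `fs` and `gs`. The parameter `q` of the
method is `2 * r * C`.

The inner product `X = γ' * ⟪a' - z, w' - w⟫` is squeezed: `‖w' - w‖ ^ 2 ≤ X` by monotonicity of
the subdifferential, and `X ≤ ρ * ‖h‖ * ‖w' - w‖` with `ρ = γ' / γ`. The gap in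
`f' - ⟪a', ys - w⟫ ≤ fs` is kept on the left. -/
theorem descent_inequality {u w w' a a' z z' ys : F} {f f' g g' g'' fs gs γ γ' r C : ℝ}
    (hγ : 0 < γ) (hγ' : 0 < γ') (hr : 1 / 2 ≤ r) (hC : 1 / 2 ≤ C)
    (hw : w = u + γ • (a - z)) (hw' : w' = w + γ' • (a' - z'))
    (hmono : 0 ≤ inner ℝ (z' - z) (w' - w))
    (h₁ : g' + inner ℝ z (w' - w) ≤ g'') (h₂ : g' + inner ℝ z (u - w) ≤ g)
    (h₃ : f' - inner ℝ a' (u - w) ≤ f) (h₄ : g'' + inner ℝ z' (ys - w') ≤ gs) :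
    1 / 2 * ‖w' - ys‖ ^ 2 + (γ' * (1 + 2 * r * C * (γ' / γ)) * (f' + g' - (fs + gs)) +
        (C - 1 / 2) * ‖w' - w‖ ^ 2) + γ' * (fs - f' + inner ℝ a' (ys - w)) ≤
      1 / 2 * ‖w - ys‖ ^ 2 + 2 * r * C * (γ' / γ) ^ 2 * γ * (f + g - (fs + gs)) +
        C * ((γ' / γ) ^ 2 * ((1 - 2 * r) * ‖w - u‖ ^ 2 + γ ^ 2 * ‖a' - a‖ ^ 2 +
          2 * (1 - r) * γ * inner ℝ (a' - a) (w - u))) := by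
  set ρ := γ' / γ with hρ
  have hρ0 : 0 < ρ := by positivity
  have hγρ : γ' = ρ * γ := by rw [hρ]; field_simp
  set h : F := (w - u) + γ • (a' - a) with hh
  have hz : γ • (a' - z) = h := by
    have : γ • (a - z) = w - u := by rw [hw]; abel
    rw [hh, ← this]; module
  have hz' : γ' • (a' - z') = w' - w := by rw [hw']; abel
  set X := γ' * inner ℝ (a' - z) (w' - w) with hX
  have hXh : X = ρ * inner ℝ h (w' - w) := by
    rw [hX, ← hz, inner_smul_left, hγρ]
    simp only [conj_trivial]; ring
  have hA : ‖w' - w‖ ^ 2 ≤ X := by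
    have e : γ' * inner ℝ (z' - z) (w' - w) = X - ‖w' - w‖ ^ 2 := by
      have : ‖w' - w‖ ^ 2 = γ' * inner ℝ (a' - z') (w' - w) := by
        rw [← real_inner_self_eq_norm_sq]
        nth_rewrite 1 [← hz']
        rw [inner_smul_left]; rfl
      rw [this, hX]
      simp only [inner_sub_left]; ring
    have := mul_nonneg hγ'.le hmono
    linarith
  have hB : X ≤ ρ * ‖h‖ * ‖w' - w‖ := by
    rw [hXh, mul_assoc]
    exact mul_le_mul_of_nonneg_left (real_inner_le_norm _ _) hρ0.le
  have hCX := le_of_sq_le_of_le_mul hC (norm_nonneg _) hA hB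
  have hD : ‖h‖ ^ 2 = ‖w - u‖ ^ 2 + 2 * γ * inner ℝ (a' - a) (w - u) + γ ^ 2 * ‖a' - a‖ ^ 2 := by
    rw [hh, norm_add_sq_real, norm_smul, Real.norm_of_nonneg hγ.le, inner_smul_right,
      real_inner_comm]
    ring
  have hE : γ' * (f' + g' - (fs + gs)) + γ' * (fs - f' + inner ℝ a' (ys - w)) ≤
      X + 1 / 2 * ‖w - ys‖ ^ 2 - 1 / 2 * ‖w' - ys‖ ^ 2 - 1 / 2 * ‖w' - w‖ ^ 2 := by
    have e1 : ‖w - ys‖ ^ 2 = ‖w' - w‖ ^ 2 - 2 * inner ℝ (w' - w) (w' - ys) + ‖w' - ys‖ ^ 2 := by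
      rw [show w - ys = (w' - ys) - (w' - w) by abel, norm_sub_sq_real, real_inner_comm]
      ring
    have e2 : inner ℝ (w' - w) (w' - ys) = γ' * inner ℝ (a' - z') (w' - ys) := by
      nth_rewrite 1 [← hz']
      rw [inner_smul_left]; rfl
    have e3 : γ' * (g' - gs + inner ℝ a' (ys - w)) ≤
        γ' * (inner ℝ (a' - z) (w' - w) - inner ℝ (a' - z') (w' - ys)) := by
      refine mul_le_mul_of_nonneg_left ?_ hγ'.le
      simp only [inner_sub_left, inner_sub_right] at *
      linarith
    rw [e1, e2, hX]
    linarith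
  have hF : γ * (f' + g' - (f + g)) ≤ -(‖w - u‖ ^ 2 + γ * inner ℝ (a' - a) (w - u)) := by
    have e1 : ‖w - u‖ ^ 2 + γ * inner ℝ (a' - a) (w - u) = γ * inner ℝ (a' - z) (w - u) := by
      have : inner ℝ h (w - u) = γ * inner ℝ (a' - z) (w - u) := by
        rw [← hz, inner_smul_left]; rfl
      rw [← this, hh, inner_add_left, real_inner_self_eq_norm_sq, inner_smul_left]; rfl
    rw [e1, ← mul_neg]
    refine mul_le_mul_of_nonneg_left ?_ hγ.le
    simp only [inner_sub_left, inner_sub_right] at *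
    linarith
  have hF' := mul_le_mul_of_nonneg_left hF
    (by positivity : 0 ≤ 2 * r * C * ρ ^ 2)
  have hγ2 : γ' * ρ = ρ ^ 2 * γ := by rw [hγρ]; ring
  have e4 : γ' * (1 + 2 * r * C * ρ) * (f' + g' - (fs + gs)) =
      γ' * (f' + g' - (fs + gs)) + 2 * r * C * ρ ^ 2 * (γ * (f' + g' - (fs + gs))) := by
    linear_combination 2 * r * C * (f' + g' - (fs + gs)) * hγ2
  rw [e4]
  have e5 : C * (ρ * ‖h‖) ^ 2 = C * ρ ^ 2 * (‖w - u‖ ^ 2 +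
      2 * γ * inner ℝ (a' - a) (w - u) + γ ^ 2 * ‖a' - a‖ ^ 2) := by
    rw [mul_pow, hD]; ring
  rw [e5] at hCX
  linarith

end OneStep

/-! ### The adaptive proximal gradient method on the dual problem -/

section DualRun

variable {F : Type*} [NormedAddCommGroup F] [InnerProductSpace ℝ F]

/-- A run `y` of the adaptive proximal gradient method on a sum `f + g` of convex functions, of
which only the data along the run are recorded: `f k` and `g k` are the values at `y k`, `-a k` is
the gradient of `f` at `y k` and `z k` is a subgradient of `g` at `y k`. The entries `g 0` and `z 0`
are not used, because `g` may be infinite at the starting point. -/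
structure IsDualRun (q r : ℝ) (y a z : ℕ → F) (f g γ : ℕ → ℝ) : Prop where
  f_le : ∀ j k, f k - inner ℝ (a k) (y j - y k) ≤ f j
  g_le : ∀ j k, g (k + 1) + inner ℝ (z (k + 1)) (y (j + 1) - y (k + 1)) ≤ g (j + 1)
  y_step : ∀ k, y (k + 1) = y k + γ (k + 1) • (a k - z (k + 1))
  γ_zero_pos : 0 < γ 0
  γ_one : γ 1 = γ 0
  γ_step : ∀ k, γ (k + 2) = nextStep q r (γ k) (γ (k + 1))
    (-(inner ℝ (a (k + 1) - a k) (y (k + 1) - y k)) / ‖y (k + 1) - y k‖ ^ 2)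
    (‖a (k + 1) - a k‖ / ‖y (k + 1) - y k‖)

/-- A minimizer `ys` of the function `f + g` of which `y` is a run: `fs` and `gs` are the values of
`f` and `g` at `ys`, the gradient of `f` at `ys` is `-as`, and `as` is a subgradient of `g`
at `ys`. -/
structure IsDualSol (y a z : ℕ → F) (f g : ℕ → ℝ) (ys as : F) (fs gs : ℝ) : Prop where
  f_le : ∀ k, f k - inner ℝ (a k) (ys - y k) ≤ fs
  g_le : ∀ k, g (k + 1) + inner ℝ (z (k + 1)) (ys - y (k + 1)) ≤ gs
  le_f : ∀ k, fs - inner ℝ as (y k - ys) ≤ f k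
  le_g : ∀ k, gs + inner ℝ as (y (k + 1) - ys) ≤ g (k + 1)

/-- The part of the Lyapunov function `1 / 2 * ‖y (k + 1) - ys‖ ^ 2 + energy` that depends on the
solution `ys` only through the optimal value `v`. -/
noncomputable def energy (q r v : ℝ) (y : ℕ → F) (f g γ : ℕ → ℝ) (k : ℕ) : ℝ :=
  γ (k + 1) * (1 + q * (γ (k + 1) / γ k)) * (f k + g k - v) +
    (q / (2 * r) - 1 / 2) * ‖y (k + 1) - y k‖ ^ 2

/-- The decrease of the Lyapunov function that is due to the stepsize `γ (k + 2)` being smaller than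
the second term of the minimum in the stepsize rule. -/
noncomputable def slack (q r : ℝ) (y a : ℕ → F) (γ : ℕ → ℝ) (k : ℕ) : ℝ :=
  (q / (2 * r) - 1 / 2) * ‖y (k + 1) - y k‖ ^ 2 -
    q / (2 * r) * ((γ (k + 2) / γ (k + 1)) ^ 2 * ((1 - 2 * r) * ‖y (k + 1) - y k‖ ^ 2 +
      γ (k + 1) ^ 2 * ‖a (k + 1) - a k‖ ^ 2 +
      2 * (1 - r) * γ (k + 1) * inner ℝ (a (k + 1) - a k) (y (k + 1) - y k)))

variable {q r : ℝ} {y a z : ℕ → F} {f g γ : ℕ → ℝ} {ys as : F} {fs gs : ℝ}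

namespace IsDualRun

theorem γ_pos (h : IsDualRun q r y a z f g γ) (hr : 1 / 2 ≤ r) (hqr : r < q) (k : ℕ) :
    0 < γ k :=
  pos_of_nextStep hr hqr h.γ_zero_pos (h.γ_one ▸ h.γ_zero_pos) (fun k => ⟨_, _, h.γ_step k⟩) k

theorem sq_ratio_le (h : IsDualRun q r y a z f g γ) (hr : 1 / 2 ≤ r) (hqr : r < q) (k : ℕ) :
    (γ (k + 2) / γ (k + 1)) ^ 2 ≤ 1 / q + γ (k + 1) / γ k := by
  rw [h.γ_step]
  exact sq_nextStep_div_le hr hqr (h.γ_pos hr hqr _) (h.γ_pos hr hqr _)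

theorem ratio_le (h : IsDualRun q r y a z f g γ) (hr : 1 / 2 ≤ r) (hqr : r < q) (k : ℕ) :
    γ (k + 1) / γ k ≤ 1 + 1 / q := by
  have hq : 0 < q := by linarith
  have hq' : 0 < 1 / q := by positivity
  induction k with
  | zero => rw [zero_add, h.γ_one, div_self h.γ_zero_pos.ne']; linarith
  | succ k ih =>
    refine le_of_sq_le_sq ((h.sq_ratio_le hr hqr k).trans ?_) (by positivity)
    nlinarith

theorem slack_nonneg (h : IsDualRun q r y a z f g γ) (hr : 1 / 2 ≤ r) (hqr : r < q) {k : ℕ}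
    (hΔ : y (k + 1) = y k → a (k + 1) = a k) : 0 ≤ slack q r y a γ k := by
  have hq : 0 < q := by linarith
  have hr0 : 0 < r := by linarith
  have hγ := h.γ_pos hr hqr
  unfold slack
  by_cases hy : y (k + 1) = y k
  · simp [hy, hΔ hy]
  · have hD : 0 < ‖y (k + 1) - y k‖ := norm_pos_iff.2 (sub_ne_zero.2 hy)
    have h1 := sq_nextStep_div_mul_stepDenom_le (q := q) (r := r) (γ' := γ k) (γ := γ (k + 1))
      (ℓ := -(inner ℝ (a (k + 1) - a k) (y (k + 1) - y k)) / ‖y (k + 1) - y k‖ ^ 2)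
      (L := ‖a (k + 1) - a k‖ / ‖y (k + 1) - y k‖) hr hqr (hγ _) (hγ _)
    rw [← h.γ_step] at h1
    have h2 := mul_le_mul_of_nonneg_right h1
      (by positivity : 0 ≤ q / (2 * r) * ‖y (k + 1) - y k‖ ^ 2)
    unfold stepDenom at h2
    have e1 : (1 - r / q) * (q / (2 * r) * ‖y (k + 1) - y k‖ ^ 2) =
        (q / (2 * r) - 1 / 2) * ‖y (k + 1) - y k‖ ^ 2 := by field_simp
    rw [e1] at h2
    refine sub_nonneg.2 (le_trans (le_of_eq ?_) h2)
    field_simp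
    ring

theorem energy_nonneg (h : IsDualRun q r y a z f g γ) (hr : 1 / 2 ≤ r) (hqr : r < q)
    (hs : IsDualSol y a z f g ys as fs gs) (k : ℕ) :
    0 ≤ energy q r (fs + gs) y f g γ (k + 1) := by
  have hq : 0 < q := by linarith
  have hr0 : 0 < r := by linarith
  have h1 := h.γ_pos hr hqr (k + 1)
  have h2 := h.γ_pos hr hqr (k + 2)
  have hc : 0 ≤ q / (2 * r) - 1 / 2 := by
    rw [sub_nonneg, div_le_div_iff₀ (by norm_num) (by positivity)]; linarith
  have hP : 0 ≤ f (k + 1) + g (k + 1) - (fs + gs) := by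
    have := hs.le_f (k + 1)
    have := hs.le_g k
    linarith
  unfold energy
  rw [show k + 1 + 1 = k + 2 from rfl]
  positivity

/-- The Lyapunov inequality. -/
theorem lyapunov (h : IsDualRun q r y a z f g γ) (hr : 1 / 2 ≤ r) (hqr : r < q)
    (hs : IsDualSol y a z f g ys as fs gs) (k : ℕ) :
    1 / 2 * ‖y (k + 3) - ys‖ ^ 2 + energy q r (fs + gs) y f g γ (k + 2) +
        γ (k + 3) * (fs - f (k + 2) + inner ℝ (a (k + 2)) (ys - y (k + 2))) +
        slack q r y a γ (k + 1) ≤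
      1 / 2 * ‖y (k + 2) - ys‖ ^ 2 + energy q r (fs + gs) y f g γ (k + 1) := by
  have hq : 0 < q := by linarith
  have hr0 : 0 < r := by linarith
  have hγ := h.γ_pos hr hqr
  have hP : 0 ≤ f (k + 1) + g (k + 1) - (fs + gs) := by
    have := hs.le_f (k + 1)
    have := hs.le_g k
    linarith
  have hmono : 0 ≤ inner ℝ (z (k + 3) - z (k + 2)) (y (k + 3) - y (k + 2)) := by
    have h1 := h.g_le (k + 2) (k + 1)
    have h2 := h.g_le (k + 1) (k + 2)
    simp only [inner_sub_left, inner_sub_right] at *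
    linarith
  have key := descent_inequality (r := r) (C := q / (2 * r)) (fs := fs) (hγ (k + 2)) (hγ (k + 3))
    hr (by rw [div_le_div_iff₀ (by norm_num) (by positivity)]; linarith)
    (h.y_step (k + 1)) (h.y_step (k + 2)) hmono (h.g_le (k + 2) (k + 1)) (h.g_le k (k + 1))
    (h.f_le (k + 1) (k + 2)) (hs.g_le (k + 2))
  have e : 2 * r * (q / (2 * r)) = q := by field_simp
  rw [e] at key
  have hratio := mul_le_mul_of_nonneg_right (h.sq_ratio_le hr hqr (k + 1))
    (by have := hγ (k + 2); positivity :
      0 ≤ q * (γ (k + 2) * (f (k + 1) + g (k + 1) - (fs + gs))))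
  have e2 : (1 / q + γ (k + 1 + 1) / γ (k + 1)) *
      (q * (γ (k + 2) * (f (k + 1) + g (k + 1) - (fs + gs)))) =
      γ (k + 2) * (1 + q * (γ (k + 2) / γ (k + 1))) * (f (k + 1) + g (k + 1) - (fs + gs)) := by
    rw [show k + 1 + 1 = k + 2 from rfl]
    field_simp
  rw [e2] at hratio
  unfold energy slack
  rw [show k + 1 + 1 = k + 2 from rfl, show k + 1 + 2 = k + 3 from rfl,
    show k + 2 + 1 = k + 3 from rfl] at *
  linarith

/-- The Lyapunov function converges and the gaps in the Lyapunov inequality vanish in the limit. -/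
theorem exists_tendsto_lyapunov (h : IsDualRun q r y a z f g γ) (hr : 1 / 2 ≤ r) (hqr : r < q)
    (hs : IsDualSol y a z f g ys as fs gs) (hΔ : ∀ k, y (k + 1) = y k → a (k + 1) = a k) :
    (∃ l, Tendsto (fun k => 1 / 2 * ‖y (k + 2) - ys‖ ^ 2 +
      energy q r (fs + gs) y f g γ (k + 1)) atTop (𝓝 l)) ∧
    Tendsto (fun k => γ (k + 3) * (fs - f (k + 2) + inner ℝ (a (k + 2)) (ys - y (k + 2))))
      atTop (𝓝 0) ∧
    Tendsto (fun k => slack q r y a γ (k + 1)) atTop (𝓝 0) ∧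
    ∃ R, ∀ k, ‖y k‖ ≤ R := by
  set V : ℕ → ℝ := fun k => 1 / 2 * ‖y (k + 2) - ys‖ ^ 2 +
    energy q r (fs + gs) y f g γ (k + 1) with hV
  have hgap : ∀ k, 0 ≤ γ (k + 3) * (fs - f (k + 2) + inner ℝ (a (k + 2)) (ys - y (k + 2))) :=
    fun k => mul_nonneg (h.γ_pos hr hqr _).le (by linarith [hs.f_le (k + 2)])
  have hsl : ∀ k, 0 ≤ slack q r y a γ (k + 1) := fun k => h.slack_nonneg hr hqr (hΔ _)
  have hly : ∀ k, V (k + 1) +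
      γ (k + 3) * (fs - f (k + 2) + inner ℝ (a (k + 2)) (ys - y (k + 2))) +
      slack q r y a γ (k + 1) ≤ V k := fun k => h.lyapunov hr hqr hs k
  have hanti : Antitone V := antitone_nat_of_succ_le fun k => by
    linarith [hly k, hgap k, hsl k]
  have hV0 : ∀ k, 0 ≤ V k := fun k =>
    add_nonneg (by positivity) (h.energy_nonneg hr hqr hs k)
  have hlim := tendsto_atTop_ciInf hanti ⟨0, by rintro _ ⟨k, rfl⟩; exact hV0 k⟩
  have hdiff : Tendsto (fun k => V k - V (k + 1)) atTop (𝓝 0) := by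
    simpa using hlim.sub (hlim.comp (tendsto_add_atTop_nat 1))
  refine ⟨⟨_, hlim⟩, squeeze_zero hgap (fun k => by linarith [hly k, hsl k]) hdiff,
    squeeze_zero hsl (fun k => by linarith [hly k, hgap k]) hdiff, ?_⟩
  refine ⟨max (max ‖y 0‖ ‖y 1‖) (‖ys‖ + (V 0 * 2 + 1)), fun k => ?_⟩
  match k with
  | 0 => exact (le_max_left _ _).trans (le_max_left _ _)
  | 1 => exact (le_max_right _ _).trans (le_max_left _ _)
  | k + 2 =>
    refine le_max_of_le_right ?_
    have h1 : V k ≤ V 0 := hanti (Nat.zero_le k)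
    have h2 : 1 / 2 * ‖y (k + 2) - ys‖ ^ 2 ≤ V k :=
      le_add_of_nonneg_right (h.energy_nonneg hr hqr hs k)
    have h3 : ‖y (k + 2) - ys‖ ≤ V 0 * 2 + 1 := by
      nlinarith [sq_nonneg (‖y (k + 2) - ys‖ - 1)]
    have h4 := norm_le_norm_add_norm_sub' (y (k + 2)) ys
    linarith

/-- The stepsizes are bounded away from zero. While the first term of the minimum is active,
`γ (k + 1) * (γ (k + 1) / γ k)` grows, by `γ (k + 1) / q` in the next step; when the second one is,
the new stepsize is at least a constant `κ`. -/
theorem exists_le_γ (h : IsDualRun q r y a z f g γ) (hr : 1 / 2 ≤ r) (hqr : r < q) {L : ℝ}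
    (hL : 0 < L) (hLip : ∀ k, ‖a (k + 1) - a k‖ ≤ L * ‖y (k + 1) - y k‖) :
    ∃ m > 0, ∀ k, m ≤ γ k := by
  have hq : 0 < q := by linarith
  have hr0 : 0 < r := by linarith
  have hγ := h.γ_pos hr hqr
  have h1 : 0 < 1 - r / q := by rw [sub_pos, div_lt_one hq]; exact hqr
  set κ := min (γ 0) √((1 - r / q) / (2 * r * L ^ 2)) with hκ
  have hκ0 : 0 < κ := lt_min (hγ 0) (by positivity)
  have hκ1 : κ ≤ γ 0 := min_le_left _ _
  have hκ2 : κ ^ 2 * (2 * r * L ^ 2) ≤ 1 - r / q := by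
    rw [← le_div_iff₀ (by positivity)]
    calc κ ^ 2 ≤ √((1 - r / q) / (2 * r * L ^ 2)) ^ 2 :=
          pow_le_pow_left₀ hκ0.le (min_le_right _ _) 2
      _ = _ := Real.sq_sqrt (by positivity)
  have hinv : ∀ k, κ ≤ γ (k + 1) ∨ κ / q ≤ γ (k + 1) * (γ (k + 1) / γ k) := by
    intro k
    induction k with
    | zero => left; rw [zero_add, h.γ_one]; exact hκ1
    | succ k ih =>
      have hℓ : 0 ≤ -(inner ℝ (a (k + 1) - a k) (y (k + 1) - y k)) / ‖y (k + 1) - y k‖ ^ 2 := by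
        refine div_nonneg ?_ (sq_nonneg _)
        have i1 := h.f_le (k + 1) k
        have i2 := h.f_le k (k + 1)
        simp only [inner_sub_left, inner_sub_right] at *
        linarith
      have hℓL : -(inner ℝ (a (k + 1) - a k) (y (k + 1) - y k)) / ‖y (k + 1) - y k‖ ^ 2 ≤
          ‖a (k + 1) - a k‖ / ‖y (k + 1) - y k‖ := by
        rcases (norm_nonneg (y (k + 1) - y k)).eq_or_lt with hD | hD
        · simp [← hD]
        · rw [div_le_div_iff₀ (by positivity) hD]
          have := (abs_le.1 (abs_real_inner_le_norm (a (k + 1) - a k) (y (k + 1) - y k))).1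
          nlinarith
      have hLL : ‖a (k + 1) - a k‖ / ‖y (k + 1) - y k‖ ≤ L :=
        div_le_of_le_mul₀ (norm_nonneg _) hL.le (hLip k)
      rcases nextStep_eq_or_le hr hqr (hγ k) (hγ (k + 1)) hℓ hℓL hLL hκ2 with e | e
      · rw [← h.γ_step] at e
        right
        rw [show k + 1 + 1 = k + 2 from rfl, e, mul_add, mul_one_div]
        have i1 : 0 ≤ γ (k + 1) / q := div_nonneg (hγ _).le hq.le
        have i2 : 0 ≤ γ (k + 1) * (γ (k + 1) / γ k) :=
          mul_nonneg (hγ _).le (div_nonneg (hγ _).le (hγ _).le)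
        rcases ih with ih | ih
        · have : κ / q ≤ γ (k + 1) / q := by gcongr
          linarith
        · linarith
      · rw [← h.γ_step] at e
        exact .inl e
  have hle : κ / (q + 1) ≤ κ := div_le_self hκ0.le (by linarith)
  refine ⟨κ / (q + 1), by positivity, fun k => ?_⟩
  match k with
  | 0 => exact hle.trans hκ1
  | k + 1 =>
    rcases hinv k with i | i
    · exact hle.trans i
    · have i2 := i.trans (mul_le_mul_of_nonneg_left (h.ratio_le hr hqr k) (hγ (k + 1)).le)
      rw [div_le_iff₀ hq] at i2
      rw [div_le_iff₀ (by linarith)]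
      have : γ (k + 1) * (1 + 1 / q) * q = γ (k + 1) * (q + 1) := by field_simp
      linarith

/-- If the gradients converge, then `z (k + 1) - a k` tends to zero, whether or not the stepsizes
are bounded: divide the vanishing `slack` by the square of the stepsize. -/
theorem tendsto_sub (h : IsDualRun q r y a z f g γ) (hr : 1 / 2 ≤ r) (hqr : r < q)
    {m R : ℝ} (hm : 0 < m) (hγm : ∀ k, m ≤ γ k) (hR : ∀ k, ‖y k‖ ≤ R)
    (hsl : Tendsto (fun k => slack q r y a γ (k + 1)) atTop (𝓝 0))
    (hΔ : ∀ k, y (k + 1) = y k → a (k + 1) = a k)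
    (ha : Tendsto a atTop (𝓝 as)) :
    Tendsto (fun k => z (k + 2) - a (k + 1)) atTop (𝓝 0) := by
  have hq : 0 < q := by linarith
  have hr0 : 0 < r := by linarith
  have hγ := h.γ_pos hr hqr
  set c := q / (2 * r) - 1 / 2 with hc
  have hc0 : 0 < c := by
    rw [hc, sub_pos, div_lt_div_iff₀ (by norm_num) (by positivity)]; linarith
  set M := 1 + 1 / q with hM
  set B := 2 * R / m with hB
  set δ : ℕ → ℝ := fun k => ‖a (k + 2) - a (k + 1)‖ with hδ
  have hδ0 : Tendsto δ atTop (𝓝 0) := by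
    have := ((ha.comp (tendsto_add_atTop_nat 2)).sub (ha.comp (tendsto_add_atTop_nat 1))).norm
    simpa using this
  have hstep : ∀ k, ‖y (k + 2) - y (k + 1)‖ = γ (k + 2) * ‖z (k + 2) - a (k + 1)‖ := fun k => by
    rw [h.y_step (k + 1), add_sub_cancel_left, norm_smul, Real.norm_of_nonneg (hγ _).le,
      norm_sub_rev]
  have heB : ∀ k, ‖z (k + 2) - a (k + 1)‖ ≤ B := fun k => by
    rw [hB, le_div_iff₀ hm]
    have h1 := norm_sub_le (y (k + 2)) (y (k + 1))
    rw [hstep] at h1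
    have h2 := mul_le_mul_of_nonneg_right (hγm (k + 2)) (norm_nonneg (z (k + 2) - a (k + 1)))
    linarith [hR (k + 2), hR (k + 1)]
  have hkey : ∀ k, c * ‖z (k + 2) - a (k + 1)‖ ^ 2 ≤ slack q r y a γ (k + 1) / m ^ 2 +
      q / (2 * r) * (M ^ 2 * (δ k ^ 2 + 2 * |1 - r| * (δ k * B))) := by
    intro k
    set e := ‖z (k + 2) - a (k + 1)‖ with he
    have he0 : 0 ≤ e := norm_nonneg _
    have hδk : 0 ≤ δ k := norm_nonneg _
    set ρ := γ (k + 3) / γ (k + 2) with hρ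
    have hρ0 : 0 < ρ := div_pos (hγ _) (hγ _)
    have hρM : ρ ≤ M := h.ratio_le hr hqr (k + 2)
    set I : ℝ := inner ℝ (a (k + 2) - a (k + 1)) (y (k + 2) - y (k + 1)) with hI
    have hs0 : 0 ≤ slack q r y a γ (k + 1) := h.slack_nonneg hr hqr (hΔ _)
    have hIle : (1 - r) * I ≤ |1 - r| * (δ k * (γ (k + 2) * B)) := by
      have h1 : |I| ≤ δ k * (γ (k + 2) * e) := by
        rw [he, ← hstep]; exact abs_real_inner_le_norm _ _
      have h2 : δ k * (γ (k + 2) * e) ≤ δ k * (γ (k + 2) * B) := by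
        have := hγ (k + 2)
        have := heB k
        gcongr
      calc (1 - r) * I ≤ |(1 - r) * I| := le_abs_self _
        _ = |1 - r| * |I| := abs_mul _ _
        _ ≤ _ := mul_le_mul_of_nonneg_left (h1.trans h2) (abs_nonneg _)
    have hN : (1 - 2 * r) * ‖y (k + 2) - y (k + 1)‖ ^ 2 + γ (k + 2) ^ 2 * δ k ^ 2 +
        2 * (1 - r) * γ (k + 2) * I ≤
        γ (k + 2) ^ 2 * (δ k ^ 2 + 2 * |1 - r| * (δ k * B)) := by
      have h1 : (1 - 2 * r) * ‖y (k + 2) - y (k + 1)‖ ^ 2 ≤ 0 :=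
        mul_nonpos_of_nonpos_of_nonneg (by linarith) (sq_nonneg _)
      have h2 := mul_le_mul_of_nonneg_left hIle (mul_nonneg zero_le_two (hγ (k + 2)).le)
      linarith
    have hB0 : 0 ≤ B := he0.trans (heB k)
    have hslack : c * (γ (k + 2) ^ 2 * e ^ 2) ≤ slack q r y a γ (k + 1) +
        q / (2 * r) * (M ^ 2 * (γ (k + 2) ^ 2 * (δ k ^ 2 + 2 * |1 - r| * (δ k * B)))) := by
      have e1 : slack q r y a γ (k + 1) = c * ‖y (k + 2) - y (k + 1)‖ ^ 2 -
          q / (2 * r) * (ρ ^ 2 * ((1 - 2 * r) * ‖y (k + 2) - y (k + 1)‖ ^ 2 +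
            γ (k + 2) ^ 2 * δ k ^ 2 + 2 * (1 - r) * γ (k + 2) * I)) := rfl
      have e2 : ‖y (k + 2) - y (k + 1)‖ ^ 2 = γ (k + 2) ^ 2 * e ^ 2 := by
        rw [hstep, mul_pow]
      have h2 : ρ ^ 2 * ((1 - 2 * r) * ‖y (k + 2) - y (k + 1)‖ ^ 2 +
            γ (k + 2) ^ 2 * δ k ^ 2 + 2 * (1 - r) * γ (k + 2) * I) ≤
          M ^ 2 * (γ (k + 2) ^ 2 * (δ k ^ 2 + 2 * |1 - r| * (δ k * B))) := by
        refine (mul_le_mul_of_nonneg_left hN (sq_nonneg _)).trans ?_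
        have : ρ ^ 2 ≤ M ^ 2 := pow_le_pow_left₀ hρ0.le hρM 2
        gcongr
      have h3 := mul_le_mul_of_nonneg_left h2 (by positivity : 0 ≤ q / (2 * r))
      rw [← e2]
      linarith
    have hγ2 : 0 < γ (k + 2) ^ 2 := pow_pos (hγ _) 2
    have hdiv : slack q r y a γ (k + 1) ≤ γ (k + 2) ^ 2 * (slack q r y a γ (k + 1) / m ^ 2) := by
      rw [← mul_div_assoc, le_div_iff₀ (by positivity), mul_comm]
      exact mul_le_mul_of_nonneg_right (pow_le_pow_left₀ hm.le (hγm _) 2) hs0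
    refine le_of_mul_le_mul_left ?_ hγ2
    linarith
  have hrhs : Tendsto (fun k => slack q r y a γ (k + 1) / m ^ 2 +
      q / (2 * r) * (M ^ 2 * (δ k ^ 2 + 2 * |1 - r| * (δ k * B)))) atTop (𝓝 0) := by
    have := (hsl.div_const (m ^ 2)).add ((((hδ0.pow 2).add
      ((hδ0.mul_const B).const_mul (2 * |1 - r|))).const_mul (M ^ 2)).const_mul (q / (2 * r)))
    simpa using this
  have h1 : Tendsto (fun k => c * ‖z (k + 2) - a (k + 1)‖ ^ 2) atTop (𝓝 0) :=
    squeeze_zero (fun k => by positivity) hkey hrhs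
  have h2 : Tendsto (fun k => ‖z (k + 2) - a (k + 1)‖ ^ 2) atTop (𝓝 0) := by
    have := h1.const_mul c⁻¹
    simpa [hc0.ne'] using this
  have h3 := h2.sqrt
  simp only [Real.sqrt_sq (norm_nonneg _), Real.sqrt_zero] at h3
  exact tendsto_zero_iff_norm_tendsto_zero.2 h3

end IsDualRun

/-- A variant of Opial's lemma: a bounded sequence converges if at each of its cluster points `b`
the sequence `‖y k - b‖ ^ 2 / 2 + e k` converges, where `e` does not depend on `b`. Indeed, for two
cluster points the differences of these sequences converge, which forces the points to agree. -/
theorem exists_tendsto_of_clusterPts [FiniteDimensional ℝ F] {R : ℝ} {P : F → Prop}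
    {e : ℕ → ℝ} (hR : ∀ k, ‖y k‖ ≤ R)
    (hP : ∀ b (φ : ℕ → ℕ), StrictMono φ → Tendsto (y ∘ φ) atTop (𝓝 b) → P b)
    (he : ∀ b, P b → ∃ l, Tendsto (fun k => 1 / 2 * ‖y k - b‖ ^ 2 + e k) atTop (𝓝 l)) :
    ∃ b, P b ∧ Tendsto y atTop (𝓝 b) := by
  have hmem : ∀ k, y k ∈ Metric.closedBall (0 : F) R := fun k => by simpa using hR k
  obtain ⟨b, -, φ, hφ, hb⟩ := tendsto_subseq_of_bounded Metric.isBounded_closedBall hmem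
  have hPb := hP b φ hφ hb
  refine ⟨b, hPb, tendsto_of_subseq_tendsto fun ns hns => ?_⟩
  obtain ⟨b', -, θ, hθ, hb'⟩ :=
    tendsto_subseq_of_bounded Metric.isBounded_closedBall fun k => hmem (ns k)
  obtain ⟨θ', hθ', hmono⟩ := strictMono_subseq_of_tendsto_atTop (hns.comp hθ.tendsto_atTop)
  have hb'' : Tendsto (y ∘ (ns ∘ θ ∘ θ')) atTop (𝓝 b') := hb'.comp hθ'.tendsto_atTop
  have hPb' := hP b' _ hmono hb''
  obtain ⟨l, hl⟩ := he b hPb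
  obtain ⟨l', hl'⟩ := he b' hPb'
  have hdiff : Tendsto (fun k => 1 / 2 * ‖y k - b‖ ^ 2 - 1 / 2 * ‖y k - b'‖ ^ 2) atTop
      (𝓝 (l - l')) := by
    simpa using hl.sub hl'
  have h1 := tendsto_nhds_unique (hdiff.comp hφ.tendsto_atTop)
    ((((hb.sub_const b).norm.pow 2).const_mul (1 / 2)).sub
      (((hb.sub_const b').norm.pow 2).const_mul (1 / 2)))
  have h2 := tendsto_nhds_unique (hdiff.comp hmono.tendsto_atTop)
    ((((hb''.sub_const b).norm.pow 2).const_mul (1 / 2)).sub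
      (((hb''.sub_const b').norm.pow 2).const_mul (1 / 2)))
  have h3 : ‖b - b'‖ ^ 2 = 0 := by
    simp only [sub_self, norm_zero] at h1 h2
    rw [norm_sub_rev b' b] at h2
    linarith
  have hbb : b' = b := (sub_eq_zero.1 (norm_eq_zero.1 (pow_eq_zero_iff two_ne_zero |>.1 h3))).symm
  exact ⟨θ, by rw [← hbb]; exact hb'⟩

end DualRun

/-! ### The primal and the dual problem -/

section Conjugate

variable {E : Type*} [NormedAddCommGroup E] [InnerProductSpace ℝ E] {ψ : E → EReal}

theorem IsSubgrad.conj_le (hp : Proper ψ) {x u : E} (h : IsSubgrad ψ x u) :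
    conj ψ u ≤ ((inner ℝ x u - (ψ x).toReal : ℝ) : EReal) := by
  refine iSup_le fun z => ?_
  by_cases hz : z ∈ effDom ψ
  · rw [← hp.coe_toReal hz]
    have := h.2 z hz
    rw [inner_sub_right, real_inner_comm z u, real_inner_comm x u] at this
    exact_mod_cast (by linarith)
  · rw [eq_top_of_notMem_effDom hz, EReal.sub_top]
    exact bot_le

theorem le_conj (hp : Proper ψ) {x : E} (hx : x ∈ effDom ψ) (u : E) :
    ((inner ℝ x u - (ψ x).toReal : ℝ) : EReal) ≤ conj ψ u := by
  refine le_trans (le_of_eq ?_) (le_iSup (fun z => ((inner ℝ z u : ℝ) : EReal) - ψ z) x)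
  rw [EReal.coe_sub, hp.coe_toReal hx]

/-- The subgradient inequality for `ψ^*`, whose value at `y` is `⟪y, z⟫ - ψ z`, where `y` is a
subgradient of `ψ` at `z`. -/
theorem IsSubgrad.conj_le_conj {z z' y y' : E} (hz : IsSubgrad ψ z y) (hz' : z' ∈ effDom ψ) :
    inner ℝ y' z' - (ψ z').toReal + inner ℝ z' (y - y') ≤ inner ℝ y z - (ψ z).toReal := by
  have := hz.2 z' hz'
  rw [inner_sub_right] at this
  rw [inner_sub_right, real_inner_comm y z', real_inner_comm y' z']
  linarith

end Conjugate

section Problem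

variable {E F : Type*} [NormedAddCommGroup E] [InnerProductSpace ℝ E]
  [NormedAddCommGroup F] [InnerProductSpace ℝ F]
  {ψ₁ : E → EReal} {ψ₂ : F → EReal} {A : E →L[ℝ] F}

/-- The Karush-Kuhn-Tucker conditions: `xs` solves the primal and `ys` the dual problem. -/
def IsKKT [CompleteSpace E] [CompleteSpace F] (ψ₁ : E → EReal) (ψ₂ : F → EReal) (A : E →L[ℝ] F)
    (xs : E) (ys : F) : Prop :=
  IsSubgrad ψ₁ xs (-(ContinuousLinearMap.adjoint A ys)) ∧ IsSubgrad ψ₂ (A xs) ys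

theorem Requirements.mem_argmin_primal_iff (h : Requirements ψ₁ ψ₂ A) {x : E} :
    x ∈ argmin (primal ψ₁ ψ₂ A) ↔ x ∈ effDom ψ₁ ∩ A ⁻¹' effDom ψ₂ ∧
      ∀ w ∈ effDom ψ₁ ∩ A ⁻¹' effDom ψ₂, (ψ₁ x).toReal + (ψ₂ (A x)).toReal ≤
        (ψ₁ w).toReal + (ψ₂ (A w)).toReal := by
  obtain ⟨x₀, hx₀, hz₀⟩ := h.relint
  refine mem_argmin_iff_of_real (D := effDom ψ₁ ∩ A ⁻¹' effDom ψ₂)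
    (Φ := fun w => (ψ₁ w).toReal + (ψ₂ (A w)).toReal)
    ⟨x₀, intrinsicInterior_subset hx₀, intrinsicInterior_subset (s := effDom ψ₂) hz₀⟩ ?_ ?_
  · rintro w ⟨hw₁, hw₂⟩
    rw [EReal.coe_add, h.proper₁.coe_toReal hw₁, h.proper₂.coe_toReal hw₂]
    rfl
  · intro w hw
    rw [Set.mem_inter_iff, not_and_or] at hw
    unfold primal
    rcases hw with hw | hw
    · rw [eq_top_of_notMem_effDom hw, EReal.top_add_of_ne_bot (h.proper₂.1 _)]
    · rw [eq_top_of_notMem_effDom (x := A w) hw, EReal.add_top_of_ne_bot (h.proper₁.1 _)]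

theorem Requirements.exists_mem_argmin_primal [FiniteDimensional ℝ E] [FiniteDimensional ℝ F]
    (h : Requirements ψ₁ ψ₂ A) : ∃ xs, xs ∈ argmin (primal ψ₁ ψ₂ A) := by
  obtain ⟨x₀, hx₀, hz₀⟩ := h.relint
  obtain ⟨u₀, hu₀⟩ := exists_isSubgrad_of_intrinsicInterior h.convex₂ hz₀
  have hd₁ := intrinsicInterior_subset hx₀
  have hd₂ := intrinsicInterior_subset hz₀
  obtain ⟨R₁, -, hR₁⟩ := h.oneCoercive₁.exists_le h.proper₁ (‖u₀‖ * ‖A‖ + 1)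
  refine exists_mem_argmin (φ := primal ψ₁ ψ₂ A) ?_ x₀
    (max R₁ ((ψ₁ x₀).toReal + ‖u₀‖ * ‖A x₀‖)) ?_
  · exact h.closed₁.add' (h.closed₂.comp A.continuous) fun x =>
      EReal.continuousAt_add (.inr (h.proper₂.1 _)) (.inl (h.proper₁.1 _))
  · intro x hx
    obtain ⟨h1, h2⟩ := max_lt_iff.1 hx
    unfold primal
    by_cases hx₁ : x ∈ effDom ψ₁
    · by_cases hx₂ : A x ∈ effDom ψ₂
      · have h3 := hR₁ x hx₁ h1.le
        have h4 := hu₀.2 _ hx₂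
        have h5 : -(‖u₀‖ * (‖A‖ * ‖x‖ + ‖A x₀‖)) ≤ inner ℝ u₀ (A x - A x₀) := by
          have ha : |inner ℝ u₀ (A x - A x₀)| ≤ ‖u₀‖ * ‖A x - A x₀‖ := abs_real_inner_le_norm _ _
          have hb : ‖A x - A x₀‖ ≤ ‖A‖ * ‖x‖ + ‖A x₀‖ :=
            (norm_sub_le _ _).trans (by gcongr; exact A.le_opNorm x)
          have := mul_le_mul_of_nonneg_left hb (norm_nonneg u₀)
          linarith [(abs_le.1 ha).1]
        rw [← h.proper₁.coe_toReal hx₁, ← h.proper₂.coe_toReal hx₂, ← h.proper₁.coe_toReal hd₁,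
          ← h.proper₂.coe_toReal hd₂]
        exact_mod_cast (by linarith)
      · rw [eq_top_of_notMem_effDom hx₂, EReal.add_top_of_ne_bot (h.proper₁.1 _)]
        exact le_top
    · rw [eq_top_of_notMem_effDom hx₁, EReal.top_add_of_ne_bot (h.proper₂.1 _)]
      exact le_top

variable [FiniteDimensional ℝ E] [FiniteDimensional ℝ F]

theorem Requirements.exists_isKKT (h : Requirements ψ₁ ψ₂ A) : ∃ xs ys, IsKKT ψ₁ ψ₂ A xs ys := by
  obtain ⟨xs, hxs⟩ := h.exists_mem_argmin_primal
  obtain ⟨⟨h₁, h₂⟩, hmin⟩ := h.mem_argmin_primal_iff.1 hxs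
  exact ⟨xs, exists_isSubgrad_of_isMin h.locallyStronglyConvex₁.1 h.convex₂ h.relint h₁ h₂
    fun x hx₁ hx₂ => hmin x ⟨hx₁, hx₂⟩⟩

/-- Given a dual solution `ys`, each primal solution minimizes the Lagrangian
`ψ₁ + ⟪ys, A ·⟫`, and the minimizer of the latter is unique by local strong convexity. -/
theorem IsKKT.argmin_primal (h : Requirements ψ₁ ψ₂ A) {xs : E} {ys : F}
    (hk : IsKKT ψ₁ ψ₂ A xs ys) : argmin (primal ψ₁ ψ₂ A) = {xs} := by
  have hin : ∀ x, inner ℝ (-(ContinuousLinearMap.adjoint A ys)) (x - xs) =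
      -inner ℝ ys (A x - A xs) := fun x => by
    rw [inner_neg_left, ContinuousLinearMap.adjoint_inner_left, map_sub]
  ext x
  rw [h.mem_argmin_primal_iff, Set.mem_singleton_iff]
  constructor
  · rintro ⟨⟨hx₁, hx₂⟩, hmin⟩
    refine hk.1.eq_of_le h.proper₁ h.locallyStronglyConvex₁ hx₁ ?_
    have h1 := hmin xs ⟨hk.1.1, hk.2.1⟩
    have h2 := hk.2.2 _ hx₂
    rw [hin]
    linarith
  · rintro rfl
    refine ⟨⟨hk.1.1, hk.2.1⟩, fun w hw => ?_⟩
    have h1 := hk.1.2 w hw.1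
    have h2 := hk.2.2 _ hw.2
    rw [hin] at h1
    linarith

theorem IsKKT.mem_argmin_dual (h : Requirements ψ₁ ψ₂ A) {xs : E} {ys : F}
    (hk : IsKKT ψ₁ ψ₂ A xs ys) : ys ∈ argmin (dual ψ₁ ψ₂ A) := by
  intro y
  have hin : ∀ y, inner ℝ xs (-(ContinuousLinearMap.adjoint A y)) = -inner ℝ (A xs) y :=
    fun y => by rw [inner_neg_right, ContinuousLinearMap.adjoint_inner_right]
  have h1 := add_le_add (hk.1.conj_le h.proper₁) (hk.2.conj_le h.proper₂)
  have h2 := add_le_add (le_conj h.proper₁ hk.1.1 (-(ContinuousLinearMap.adjoint A y)))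
    (le_conj h.proper₂ hk.2.1 y)
  refine h1.trans (le_trans (le_of_eq ?_) h2)
  rw [hin, hin, ← EReal.coe_add, ← EReal.coe_add]
  congr 1
  ring

end Problem

/-! ### The alternating minimization algorithm -/

section Run

variable {E F : Type*} [NormedAddCommGroup E] [InnerProductSpace ℝ E]
  [NormedAddCommGroup F] [InnerProductSpace ℝ F]
  {ψ₁ : E → EReal} {ψ₂ : F → EReal} {A : E →L[ℝ] F}

theorem Requirements.argmin_prox (h : Requirements ψ₁ ψ₂ A) {γ : ℝ} (hγ : 0 < γ) {v z : F}
    (hz : IsSubgrad ψ₂ z (γ • (v - z))) :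
    prox (fun w => ((γ⁻¹ : ℝ) : EReal) * ψ₂ w) v = {z} := by
  refine hz.argmin_eq_singleton (a := 0) (inv_pos.2 hγ) hγ (fun w hw => ?_) fun w hw => ?_
  · dsimp only
    rw [← h.proper₂.coe_toReal hw, ← EReal.coe_mul, ← EReal.coe_add, EReal.toReal_coe]
    congr 1
    field_simp
    ring
  · dsimp only
    rw [eq_top_of_notMem_effDom hw, EReal.coe_mul_top_of_pos (inv_pos.2 hγ), EReal.top_add_coe]

theorem Requirements.argmin_augLag (h : Requirements ψ₁ ψ₂ A) {γ : ℝ} (hγ : 0 < γ) {x : E}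
    (hx : x ∈ effDom ψ₁) {y z : F} (hz : IsSubgrad ψ₂ z (γ • (γ⁻¹ • y + A x - z))) :
    argmin (fun w => augLag ψ₁ ψ₂ A γ x w y) = {z} := by
  refine hz.argmin_eq_singleton (a := (ψ₁ x).toReal - γ⁻¹ / 2 * ‖y‖ ^ 2) one_pos hγ
    (fun w hw => ?_) fun w hw => ?_
  · unfold augLag
    rw [← h.proper₂.coe_toReal hw, ← h.proper₁.coe_toReal hx, ← EReal.coe_add, ← EReal.coe_add,
      EReal.toReal_coe, EReal.toReal_coe]
    congr 1
    have e : ‖w - (γ⁻¹ • y + A x)‖ ^ 2 =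
        ‖A x - w‖ ^ 2 + 2 * (γ⁻¹ * inner ℝ y (A x - w)) + γ⁻¹ ^ 2 * ‖y‖ ^ 2 := by
      rw [show w - (γ⁻¹ • y + A x) = -((A x - w) + γ⁻¹ • y) by abel, norm_neg, norm_add_sq_real,
        norm_smul, inner_smul_right, real_inner_comm, mul_pow, Real.norm_eq_abs, sq_abs]
    rw [e]
    field_simp
    ring
  · unfold augLag
    rw [eq_top_of_notMem_effDom hw, EReal.add_top_of_ne_bot (h.proper₁.1 x), EReal.top_add_coe]

theorem smul_prox_center_sub {γ : ℝ} (hγ : 0 < γ) (y b z : F) :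
    γ • (γ⁻¹ • y + b - z) = y + γ • (b - z) := by
  rw [add_sub_assoc, smul_add, smul_smul, mul_inv_cancel₀ hγ.ne', one_smul]

theorem Requirements.exists_isSubgrad_z [FiniteDimensional ℝ F] (h : Requirements ψ₁ ψ₂ A) {γ : ℝ}
    (hγ : 0 < γ) (v : F) : ∃ z, IsSubgrad ψ₂ z (γ • (v - z)) := by
  obtain ⟨_, -, hz₀⟩ := h.relint
  obtain ⟨u₀, hu₀⟩ := exists_isSubgrad_of_intrinsicInterior h.convex₂ hz₀
  exact exists_isSubgrad_prox h.proper₂ h.closed₂ h.convex₂ hu₀ hγ v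

theorem IsRun.γ_pos {q r : ℝ} {y₀ : F} {γ₀ : ℝ} {x : ℕ → E} {z y : ℕ → F} {γ : ℕ → ℝ}
    (R : IsRun ψ₁ ψ₂ A q r y₀ γ₀ x z y γ) (hqr : r < q) (hr : 1 / 2 ≤ r)
    (hγ₀ : 0 < γ₀) (k : ℕ) : 0 < γ k :=
  pos_of_nextStep hr hqr (by rwa [R.γ_init]) (by rwa [R.γ_init'])
    (fun k => ⟨_, _, R.γ_step k⟩) k

/-- The data from which the next iterates are computed: the dual iterates `y`, `y'` with
consecutive indices, the iterate `z` with the index of `y'`, and the two stepsizes. -/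
structure RunState (F : Type*) where
  y : F
  z : F
  y' : F
  γ : ℝ
  γ' : ℝ

/-- The iteration of the algorithm, with selections `X` and `Z` of the minimizers. -/
noncomputable def runState (A : E →L[ℝ] F) (X : F → E) (Z : ℝ → F → F) (q r : ℝ) (y₀ : F)
    (γ₀ : ℝ) : ℕ → RunState F
  | 0 =>
    let z := Z γ₀ (γ₀⁻¹ • y₀ + A (X y₀))
    ⟨y₀, z, y₀ + γ₀ • (A (X y₀) - z), γ₀, γ₀⟩
  | k + 1 =>
    let s := runState A X Z q r y₀ γ₀ k
    let γ := nextStep q r s.γ s.γ' (ell A (X s.y) (X s.y') s.y s.y')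
      (lip A (X s.y) (X s.y') s.y s.y')
    let z := Z γ (γ⁻¹ • s.y' + A (X s.y'))
    ⟨s.y', z, s.y' + γ • (A (X s.y') - z), s.γ', γ⟩

variable [FiniteDimensional ℝ E] [FiniteDimensional ℝ F]

theorem Requirements.argmin_x (h : Requirements ψ₁ ψ₂ A) {x : E} {y : F}
    (hx : IsSubgrad ψ₁ x (-(ContinuousLinearMap.adjoint A y))) :
    argmin (fun u => ψ₁ u + ((inner ℝ y (A u) : ℝ) : EReal)) = {x} := by
  have hin : ∀ w, inner ℝ (-(ContinuousLinearMap.adjoint A y)) (w - x) =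
      -inner ℝ y (A w) + inner ℝ y (A x) := fun w => by
    rw [inner_neg_left, ContinuousLinearMap.adjoint_inner_left, map_sub, inner_sub_right]
    ring
  ext w
  rw [mem_argmin_iff_of_real (D := effDom ψ₁)
    (Φ := fun u => (ψ₁ u).toReal + inner ℝ y (A u)) ⟨x, hx.1⟩
    (fun u hu => by rw [EReal.coe_add, h.proper₁.coe_toReal hu])
    (fun u hu => by rw [eq_top_of_notMem_effDom hu, EReal.top_add_coe]), Set.mem_singleton_iff]
  constructor
  · rintro ⟨hw, hmin⟩
    refine hx.eq_of_le h.proper₁ h.locallyStronglyConvex₁ hw ?_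
    rw [hin]
    linarith [hmin x hx.1]
  · rintro rfl
    refine ⟨hx.1, fun u hu => ?_⟩
    have := hx.2 u hu
    rw [hin] at this
    linarith

theorem Requirements.exists_isSubgrad_x (h : Requirements ψ₁ ψ₂ A) (y : F) :
    ∃ x, IsSubgrad ψ₁ x (-(ContinuousLinearMap.adjoint A y)) :=
  h.oneCoercive₁.exists_isSubgrad h.proper₁ h.closed₁ _

theorem Requirements.exists_isRun (h : Requirements ψ₁ ψ₂ A) {q r : ℝ} (hqr : r < q)
    (hr : 1 / 2 ≤ r) (y₀ : F) {γ₀ : ℝ} (hγ₀ : 0 < γ₀) :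
    ∃ x z y γ, IsRun ψ₁ ψ₂ A q r y₀ γ₀ x z y γ := by
  choose X hX using h.exists_isSubgrad_x
  have hZ' : ∀ (γ : ℝ) (v : F), ∃ z, 0 < γ → IsSubgrad ψ₂ z (γ • (v - z)) := fun γ v => by
    by_cases hγ : 0 < γ
    · obtain ⟨z, hz⟩ := h.exists_isSubgrad_z hγ v
      exact ⟨z, fun _ => hz⟩
    · exact ⟨0, fun hγ' => absurd hγ' hγ⟩
  choose Z hZ using hZ'
  set s := runState A X Z q r y₀ γ₀
  have hγ : ∀ k, 0 < (s k).γ := pos_of_nextStep hr hqr hγ₀ hγ₀ fun k => ⟨_, _, rfl⟩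
  refine ⟨fun k => X (s k).y, fun | 0 => 0 | k + 1 => (s k).z, fun k => (s k).y,
    fun k => (s k).γ, rfl, rfl, rfl, rfl, ?_, fun k => h.argmin_x (hX _), fun k => rfl,
    fun k => ?_, fun k => ?_⟩
  · exact h.argmin_augLag hγ₀ (hX _).1 (hZ _ _ hγ₀)
  · exact h.argmin_prox (hγ (k + 2)) (hZ _ _ (hγ (k + 2)))
  · cases k <;> rfl

section

variable {q r : ℝ} {y₀ : F} {γ₀ : ℝ} {x : ℕ → E} {z y : ℕ → F} {γ : ℕ → ℝ}

namespace IsRun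

theorem isSubgrad_x (h : Requirements ψ₁ ψ₂ A) (R : IsRun ψ₁ ψ₂ A q r y₀ γ₀ x z y γ) (k : ℕ) :
    IsSubgrad ψ₁ (x k) (-(ContinuousLinearMap.adjoint A (y k))) := by
  obtain ⟨x', hx'⟩ := h.exists_isSubgrad_x (y k)
  have e := (R.x_step k).symm.trans (h.argmin_x hx')
  rwa [Set.singleton_injective e]

theorem isSubgrad_z (h : Requirements ψ₁ ψ₂ A) (R : IsRun ψ₁ ψ₂ A q r y₀ γ₀ x z y γ)
    (hqr : r < q) (hr : 1 / 2 ≤ r) (hγ₀ : 0 < γ₀) (k : ℕ) :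
    IsSubgrad ψ₂ (z (k + 1)) (y (k + 1)) := by
  have hγ := R.γ_pos hqr hr hγ₀ (k + 1)
  obtain ⟨z', hz'⟩ := h.exists_isSubgrad_z hγ ((γ (k + 1))⁻¹ • y k + A (x k))
  have e : z (k + 1) = z' := by
    cases k with
    | zero =>
      exact Set.singleton_injective
        (R.z_init.symm.trans (h.argmin_augLag hγ (R.isSubgrad_x h 0).1 hz'))
    | succ k => exact Set.singleton_injective ((R.z_step k).symm.trans (h.argmin_prox hγ hz'))
  rw [R.y_step k, e, ← smul_prox_center_sub hγ]
  exact hz'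

end IsRun

/-- The subgradient inequality for `y ↦ ψ₁^* (-Aᵀ y)`, whose value and gradient at `y` are
`-ψ₁ x - ⟪y, A x⟫` and `-A x`, where `-Aᵀ y` is a subgradient at `x`. -/
theorem conj_adjoint_le {x x' : E} {y y' : F}
    (hx : IsSubgrad ψ₁ x (-(ContinuousLinearMap.adjoint A y))) (hx' : x' ∈ effDom ψ₁) :
    -(ψ₁ x').toReal - inner ℝ y' (A x') - inner ℝ (A x') (y - y') ≤
      -(ψ₁ x).toReal - inner ℝ y (A x) := by
  have := hx.2 x' hx'
  rw [inner_neg_left, ContinuousLinearMap.adjoint_inner_left, map_sub, inner_sub_right] at this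
  rw [inner_sub_right, real_inner_comm y (A x'), real_inner_comm y' (A x')]
  linarith

namespace IsRun

/-- The algorithm is the adaptive proximal gradient method on the dual problem. -/
theorem isDualRun (h : Requirements ψ₁ ψ₂ A) (R : IsRun ψ₁ ψ₂ A q r y₀ γ₀ x z y γ)
    (hqr : r < q) (hr : 1 / 2 ≤ r) (hγ₀ : 0 < γ₀) :
    IsDualRun q r y (fun k => A (x k)) z (fun k => -(ψ₁ (x k)).toReal - inner ℝ (y k) (A (x k)))
      (fun k => inner ℝ (y k) (z k) - (ψ₂ (z k)).toReal) γ where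
  f_le j k := conj_adjoint_le (R.isSubgrad_x h j) (R.isSubgrad_x h k).1
  g_le j k := (R.isSubgrad_z h hqr hr hγ₀ j).conj_le_conj (R.isSubgrad_z h hqr hr hγ₀ k).1
  y_step := R.y_step
  γ_zero_pos := R.γ_pos hqr hr hγ₀ 0
  γ_one := R.γ_init'.trans R.γ_init.symm
  γ_step := R.γ_step

theorem isDualSol (h : Requirements ψ₁ ψ₂ A) (R : IsRun ψ₁ ψ₂ A q r y₀ γ₀ x z y γ)
    (hqr : r < q) (hr : 1 / 2 ≤ r) (hγ₀ : 0 < γ₀) {xs : E} {ys : F} (hk : IsKKT ψ₁ ψ₂ A xs ys) :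
    IsDualSol y (fun k => A (x k)) z (fun k => -(ψ₁ (x k)).toReal - inner ℝ (y k) (A (x k)))
      (fun k => inner ℝ (y k) (z k) - (ψ₂ (z k)).toReal) ys (A xs)
      (-(ψ₁ xs).toReal - inner ℝ ys (A xs)) (inner ℝ ys (A xs) - (ψ₂ (A xs)).toReal) where
  f_le k := conj_adjoint_le hk.1 (R.isSubgrad_x h k).1
  g_le k := hk.2.conj_le_conj (R.isSubgrad_z h hqr hr hγ₀ k).1
  le_f k := conj_adjoint_le (R.isSubgrad_x h k) hk.1.1
  le_g k := (R.isSubgrad_z h hqr hr hγ₀ k).conj_le_conj hk.2.1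

/-- Boundedness of the dual iterates turns the local Lipschitz continuity of the dual gradient into
a Lipschitz bound along the run. -/
theorem exists_lipschitz (h : Requirements ψ₁ ψ₂ A) (R : IsRun ψ₁ ψ₂ A q r y₀ γ₀ x z y γ)
    {B : ℝ} (hB : ∀ k, ‖y k‖ ≤ B) :
    ∃ L > 0, ∀ k, ‖A (x (k + 1)) - A (x k)‖ ≤ L * ‖y (k + 1) - y k‖ := by
  set T := ContinuousLinearMap.adjoint A
  obtain ⟨L, hL, hlip⟩ := h.oneCoercive₁.exists_lipschitz h.proper₁ h.closed₁
    h.locallyStronglyConvex₁ (‖T‖ * B)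
  have hT : ∀ k, ‖-(T (y k))‖ ≤ ‖T‖ * B := fun k => by
    rw [norm_neg]
    exact (T.le_opNorm _).trans (mul_le_mul_of_nonneg_left (hB k) (norm_nonneg _))
  refine ⟨‖A‖ * (L * ‖T‖) + 1, by positivity, fun k => ?_⟩
  have h1 := hlip _ _ _ _ (hT (k + 1)) (hT k) (R.isSubgrad_x h (k + 1)) (R.isSubgrad_x h k)
  have h2 : ‖-(T (y (k + 1))) - -(T (y k))‖ ≤ ‖T‖ * ‖y (k + 1) - y k‖ := by
    rw [neg_sub_neg, ← map_sub, norm_sub_rev (y (k + 1))]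
    exact T.le_opNorm _
  calc ‖A (x (k + 1)) - A (x k)‖ ≤ ‖A‖ * ‖x (k + 1) - x k‖ := by
        rw [← map_sub]; exact A.le_opNorm _
    _ ≤ ‖A‖ * (L * (‖T‖ * ‖y (k + 1) - y k‖)) := by
        gcongr; exact h1.trans (by gcongr)
    _ ≤ (‖A‖ * (L * ‖T‖) + 1) * ‖y (k + 1) - y k‖ := by
        linarith [norm_nonneg (y (k + 1) - y k)]

theorem tendsto (h : Requirements ψ₁ ψ₂ A) (R : IsRun ψ₁ ψ₂ A q r y₀ γ₀ x z y γ)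
    (hqr : r < q) (hr : 1 / 2 ≤ r) (hγ₀ : 0 < γ₀) {xs : E} {ys₀ : F}
    (hk : IsKKT ψ₁ ψ₂ A xs ys₀) :
    Tendsto x atTop (𝓝 xs) ∧ ∃ ys, IsKKT ψ₁ ψ₂ A xs ys ∧ Tendsto y atTop (𝓝 ys) := by
  have D := R.isDualRun h hqr hr hγ₀
  have hΔ : ∀ k, y (k + 1) = y k → A (x (k + 1)) = A (x k) := fun k e => by
    have h1 := R.isSubgrad_x h (k + 1)
    rw [e] at h1
    rw [(R.isSubgrad_x h k).unique h.proper₁ h.locallyStronglyConvex₁ h1]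
  obtain ⟨-, hgap, hsl, B, hB⟩ :=
    D.exists_tendsto_lyapunov hr hqr (R.isDualSol h hqr hr hγ₀ hk) hΔ
  obtain ⟨L, hL, hLip⟩ := R.exists_lipschitz h hB
  obtain ⟨m, hm, hγm⟩ := D.exists_le_γ hr hqr hL hLip
  have hx : Tendsto x atTop (𝓝 xs) := by
    rw [← tendsto_add_atTop_iff_nat 2]
    refine hk.1.tendsto_of_gap h.proper₁ h.locallyStronglyConvex₁
      (fun k => (R.isSubgrad_x h (k + 2)).1) ?_
    refine squeeze_zero (fun k => by linarith [hk.1.2 _ (R.isSubgrad_x h (k + 2)).1])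
      (fun k => ?_) (by simpa using hgap.div_const m)
    rw [le_div_iff₀ hm]
    have e : -(ψ₁ xs).toReal - inner ℝ ys₀ (A xs) -
        (-(ψ₁ (x (k + 2))).toReal - inner ℝ (y (k + 2)) (A (x (k + 2)))) +
        inner ℝ (A (x (k + 2))) (ys₀ - y (k + 2)) =
        (ψ₁ (x (k + 2))).toReal - (ψ₁ xs).toReal -
          inner ℝ (-(ContinuousLinearMap.adjoint A ys₀)) (x (k + 2) - xs) := by
      rw [inner_neg_left, ContinuousLinearMap.adjoint_inner_left, map_sub, inner_sub_right,
        inner_sub_right, real_inner_comm ys₀ (A (x (k + 2))),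
        real_inner_comm (y (k + 2)) (A (x (k + 2)))]
      ring
    rw [e, mul_comm]
    exact mul_le_mul_of_nonneg_right (hγm _)
      (by linarith [hk.1.2 _ (R.isSubgrad_x h (k + 2)).1])
  have ha : Tendsto (fun k => A (x k)) atTop (𝓝 (A xs)) := (A.continuous.tendsto xs).comp hx
  have hz : Tendsto (fun k => z (k + 2)) atTop (𝓝 (A xs)) := by
    simpa using (D.tendsto_sub hr hqr hm hγm hB hsl hΔ ha).add
      (ha.comp (tendsto_add_atTop_nat 1))
  refine ⟨hx, ?_⟩
  obtain ⟨b, hb, hyb⟩ := exists_tendsto_of_clusterPts (y := fun k => y (k + 2))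
    (P := IsKKT ψ₁ ψ₂ A xs) (e := fun k => energy q r (-(ψ₁ xs).toReal - (ψ₂ (A xs)).toReal) y
      (fun k => -(ψ₁ (x k)).toReal - inner ℝ (y k) (A (x k)))
      (fun k => inner ℝ (y k) (z k) - (ψ₂ (z k)).toReal) γ (k + 1))
    (fun k => hB (k + 2))
    (fun b φ hφ hyφ => ⟨
      IsSubgrad.of_tendsto h.proper₁ h.closed₁
        ((hx.comp (tendsto_add_atTop_nat 2)).comp hφ.tendsto_atTop)
        ((((ContinuousLinearMap.adjoint A).continuous.tendsto b).comp hyφ).neg)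
        fun k => R.isSubgrad_x h (φ k + 2),
      IsSubgrad.of_tendsto h.proper₂ h.closed₂ (hz.comp hφ.tendsto_atTop) hyφ
        fun k => R.isSubgrad_z h hqr hr hγ₀ (φ k + 1)⟩)
    (fun b hb => by
      have := (D.exists_tendsto_lyapunov hr hqr (R.isDualSol h hqr hr hγ₀ hb) hΔ).1
      rwa [show -(ψ₁ xs).toReal - inner ℝ b (A xs) + (inner ℝ b (A xs) - (ψ₂ (A xs)).toReal) =
        -(ψ₁ xs).toReal - (ψ₂ (A xs)).toReal by ring] at this)
  exact ⟨b, hb, (tendsto_add_atTop_iff_nat 2).1 hyb⟩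

end IsRun

end

end Run

end AdaAMA

theorem mainTheorem5 (n m : ℕ)
    (ψ₁ : EuclideanSpace ℝ (Fin n) → EReal) (ψ₂ : EuclideanSpace ℝ (Fin m) → EReal)
    (A : EuclideanSpace ℝ (Fin n) →L[ℝ] EuclideanSpace ℝ (Fin m))
    (h : AdaAMA.Requirements ψ₁ ψ₂ A)
    (q r : ℝ) (hqr : r < q) (hr : 1 / 2 ≤ r) :
    ∃ xs : EuclideanSpace ℝ (Fin n), AdaAMA.argmin (AdaAMA.primal ψ₁ ψ₂ A) = {xs} ∧
      ∀ (y₀ : EuclideanSpace ℝ (Fin m)) (γ₀ : ℝ), 0 < γ₀ →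
        (∃ x z y γ, AdaAMA.IsRun ψ₁ ψ₂ A q r y₀ γ₀ x z y γ) ∧
        ∀ x z y γ, AdaAMA.IsRun ψ₁ ψ₂ A q r y₀ γ₀ x z y γ →
          Tendsto x atTop (𝓝 xs) ∧
          ∃ ys ∈ AdaAMA.argmin (AdaAMA.dual ψ₁ ψ₂ A), Tendsto y atTop (𝓝 ys) := by
  obtain ⟨xs, ys₀, hk⟩ := h.exists_isKKT
  refine ⟨xs, hk.argmin_primal h, fun y₀ γ₀ hγ₀ =>
    ⟨h.exists_isRun hqr hr y₀ hγ₀, fun x z y γ R => ?_⟩⟩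
  obtain ⟨hx, ys, hks, hy⟩ := R.tendsto h hqr hr hγ₀ hk
  exact ⟨hx, ys, hks.mem_argmin_dual h, hy⟩
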